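/- Let $\Lambda_3=\{y\in\mathbb R^3:\ y_1+y_2>0,\ \Delta(y)>0\}$, where $\Delta(y)=y_1^2-y_2^2-y_3^2$, be the Lorentz cone in $\mathbb R^3$, let $T_{\Lambda_3}=\mathbb R^3+i\Lambda_3\subset\mathbb C^3$ be the tube domain over it, and let $\Pi^+=\{z\in\mathbb C:\operatorname{Im} z>0\}$. The Hardy space $H^2(T_{\Lambda_3})$ consists of the holomorphic functions $F$ on $T_{\Lambda_3}$ with $$\|F\|_{H^2(T_{\Lambda_3})}=\Big(\sup_{y\in\Lambda_3}\int_{\mathbb R^3}|F(x+iy)|^2\,dx\Big)^{1/2}<\infty .$$ For $\alpha>-1$, the weighted Bergman space $A^2_\alpha(\Pi^+)$ consists of the holomorphic functions $G$ on $\Pi^+$ with $$\|G\|_{A^2_\alpha(\Pi^+)}=\Big(\int_{\Pi^+}|G(x+iy)|^2\,y^\alpha\,dx\,dy\Big)^{1/2}<\infty .$$ The Box operator is $\Box=\Delta\big(\tfrac1i\tfrac{\partial}{\partial x}\big)=-\partial_{x_1}^2+\partial_{x_2}^2+\partial_{x_3}^2$. For an integer $m\ge 0$, a positive Borel measure $\nu$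 on $T_{\Lambda_3}$ is called an $m$-box Carleson measure for $H^2(T_{\Lambda_3})$ if there is a constant $C>0$ such that $$\int_{T_{\Lambda_3}}|\Box^mF|^2\,d\nu\le C\,\|F\|_{H^2(T_{\Lambda_3})}^2\qquad\text{for every }F\in H^2(T_{\Lambda_3}).$$ A positive Borel measure $\mu$ on $\Pi^+$ is called a Carleson measure for $A^2_\alpha(\Pi^+)$ if there is a constant $C>0$ such that $$\int_{\Pi^+}|G|^2\,d\mu\le C\,\|G\|_{A^2_\alpha(\Pi^+)}^2\qquad\text{for every }G\in A^2_\alpha(\Pi^+).$$ **Theorem.** Let $\mu$ be a positive Borel measure on $\Pi^+$ and let $m\ge 0$ be an integer. Let $\delta_0$ denote the Dirac measure at the origin of $\mathbb C\times\mathbb C$. Then the following two properties are equivalent. 1. The product measure $\mu(z_1)\,\delta_0(z_2,z_3)$ is an $m$-box Carleson measure for $H^2(T_{\Lambda_3})$. 2. $\mu$ is a Carleson measure for $A^2_{4m+1}(\Pi^+)$. -/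

import Mathlib

open MeasureTheory
open scoped NNReal ENNReal

namespace LorentzTube

/-- The Lorentz form `Δ(y) = y₁² - y₂² - y₃²` on `ℝ³`, the determinant function of the cone. -/
def lorentzForm (y : Fin 3 → ℝ) : ℝ := y 0 ^ 2 - y 1 ^ 2 - y 2 ^ 2

/-- The Lorentz cone `Λ₃` of `ℝ³`. -/
def lorentzCone : Set (Fin 3 → ℝ) := {y | 0 < y 0 + y 1 ∧ 0 < lorentzForm y}

/-- The tube domain `T = ℝ³ + iΛ₃` in `ℂ³`. -/
def tube : Set (Fin 3 → ℂ) := {z | (fun j => (z j).im) ∈ lorentzCone}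

/-- The point `x + iy` of `ℂ³`. -/
def cpoint (x y : Fin 3 → ℝ) : Fin 3 → ℂ := fun j => (x j : ℂ) + Complex.I * (y j : ℂ)

/-- The norm of the Hardy space `H²(T)`:
`‖F‖ = (sup_{y ∈ Λ₃} ∫_{ℝ³} |F(x + iy)|² dx)^{1/2}`, with values in `[0, ∞]`. -/
noncomputable def hardyNorm (F : (Fin 3 → ℂ) → ℂ) : ℝ≥0∞ :=
  (⨆ y ∈ lorentzCone, ∫⁻ x : Fin 3 → ℝ, ‖F (cpoint x y)‖ₑ ^ 2) ^ (1 / 2 : ℝ)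

/-- `F` belongs to `H²(T)`. Only the values of `F` on the tube matter. -/
def MemHardy (F : (Fin 3 → ℂ) → ℂ) : Prop :=
  DifferentiableOn ℂ F tube ∧ hardyNorm F < ∞

/-- The operator `(1/i) ∂/∂x_j`. On a holomorphic function, `∂/∂x_j` is the complex partial
derivative `∂/∂z_j`. -/
noncomputable def partialD (j : Fin 3) (F : (Fin 3 → ℂ) → ℂ) : (Fin 3 → ℂ) → ℂ :=
  fun z => (1 / Complex.I) * fderiv ℂ F z (Pi.single j 1)

/-- The Box operator `□ = Δ((1/i) ∂/∂x)`. -/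
noncomputable def box (F : (Fin 3 → ℂ) → ℂ) : (Fin 3 → ℂ) → ℂ :=
  fun z => partialD 0 (partialD 0 F) z - partialD 1 (partialD 1 F) z
    - partialD 2 (partialD 2 F) z

/-- `ν` is an `m`-box Carleson measure for `H²(T)`. -/
def IsBoxCarleson (m : ℕ) (ν : Measure (Fin 3 → ℂ)) : Prop :=
  ∃ C : ℝ≥0, 0 < C ∧ ∀ F : (Fin 3 → ℂ) → ℂ, MemHardy F →
    ∫⁻ z in tube, ‖(box^[m] F) z‖ₑ ^ 2 ∂ν ≤ C * hardyNorm F ^ 2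

/-- The open upper half-plane `Π⁺`. -/
def halfPlane : Set ℂ := {z | 0 < z.im}

/-- The norm of the weighted Bergman space `A²_α(Π⁺)`:
`‖G‖ = (∫_{Π⁺} |G(x + iy)|² y^α dx dy)^{1/2}`, with values in `[0, ∞]`. -/
noncomputable def bergmanNorm (α : ℝ) (G : ℂ → ℂ) : ℝ≥0∞ :=
  (∫⁻ z in halfPlane, ‖G z‖ₑ ^ 2 * ENNReal.ofReal (z.im ^ α)) ^ (1 / 2 : ℝ)

/-- `G` belongs to `A²_α(Π⁺)`. -/
def MemBergman (α : ℝ) (G : ℂ → ℂ) : Prop :=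
  DifferentiableOn ℂ G halfPlane ∧ bergmanNorm α G < ∞

/-- `μ` is a Carleson measure for `A²_α(Π⁺)`. -/
def IsBergmanCarleson (α : ℝ) (μ : Measure ℂ) : Prop :=
  ∃ C : ℝ≥0, 0 < C ∧ ∀ G : ℂ → ℂ, MemBergman α G →
    ∫⁻ z in halfPlane, ‖G z‖ₑ ^ 2 ∂μ ≤ C * bergmanNorm α G ^ 2

/-- The measure `μ(z₁) δ₀(z₂, z₃)` on `ℂ³`: the product of `μ` and the Dirac measure at the
origin of `ℂ × ℂ`, under the identification of `ℂ × (ℂ × ℂ)` with `ℂ³`. -/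
noncomputable def prodDirac (μ : Measure ℂ) : Measure (Fin 3 → ℂ) :=
  (μ.prod (Measure.dirac ((0, 0) : ℂ × ℂ))).map (fun p => ![p.1, p.2.1, p.2.2])

end LorentzTube

/-! The measure in property 1 lives on the slice `(z, 0, 0)`, so both properties test `μ` against
functions on the half-plane: property 1 against `R F (z) = □^m F (z, 0, 0)` with `F` in the Hardy
space, property 2 against all of `A²_{4m+1}`. They are equivalent because `R` is bounded from the
Hardy space to `A²_{4m+1}` and has a bounded right inverse.

Both facts are read off on the Fourier side. By Paley-Wiener, `F` is the Laplace transform of a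
density `f` in `L²` of the closed cone, which is its own dual; `□^m` multiplies `f` by `(4π²
Δ(ξ))^m`, and restriction to the slice integrates the result over the planes `ξ_0 = t`. So `R F` is
the one-dimensional Laplace transform of `g(t) = ∫ (4π² Δ(t, η))^m f(t, η) dη`. Plancherel on
horizontal lines and a Gamma integral turn the squared norm of `A²_n` into `∫ n! (4πt)^{-(n+1)}
|g(t)|² dt`.

Cauchy-Schwarz on each plane bounds `|g(t)|²` by a constant times `∫ Δ(t, η)^{2m} dη · ∫ |f(t, η)|²
dη`. The first integral is a multiple of `t^{4m+2}` by homogeneity, which cancels the weight exactly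
when `n = 4m+1`: this is `bergmanNorm_box_laplace_sq_le`. The equality case, `f` proportional to
`t^{-(4m+2)} Δ^m g(t)`, defines `liftDensity` and gives the right inverse
(`exists_hardy_extension`).

Only the inequality `‖𝓕 g‖ ≤ ‖g‖` for integrable `g` is used, applied to `𝓕` or to its inverse
according to the direction. The Paley-Wiener representation is proved for functions uniformly
integrable on the fibres: a contour shift shows that `e^{2π y·ξ}` times the Fourier transform of
`F(· + iy)` does not depend on `y`, and scaling `y` to zero and to infinity bounds this function and
confines its support to the dual cone. General functions are reached by regularisation and Fatou's
lemma: a holomorphic cutoff on the tube, a translation and a cutoff on the half-plane. -/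

/-! ### Plancherel's inequality for integrable functions -/

open FourierTransform in
-- Against a smooth compactly supported `φ`, both sides integrate to `∫ 𝓕 φ · g`: the `L²` transform
-- because it agrees with the distributional one, the integral transform by Fubini.
theorem fourier_toLp_ae_eq {E : Type*} [NormedAddCommGroup E] [InnerProductSpace ℝ E]
    [FiniteDimensional ℝ E] [MeasurableSpace E] [BorelSpace E] {g : E → ℂ}
    (hg : Integrable g) (hg2 : MemLp g 2) : (𝓕 (hg2.toLp g) : Lp ℂ 2 (volume : Measure E)) =ᵐ[volume] 𝓕 g := by
  have hc : Continuous (𝓕 g) :=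
    VectorFourier.fourierIntegral_continuous Real.continuous_fourierChar
      (by exact continuous_inner) hg
  apply ae_eq_of_integral_contDiff_smul_eq
  · exact (Lp.memLp _).locallyIntegrable (by norm_num)
  · exact hc.locallyIntegrable
  · intro φ hφ hφc
    have hs : HasCompactSupport (fun x => (φ x : ℂ)) := hφc.comp_left (g := fun x : ℝ => (x : ℂ)) (by simp)
    have hd : ContDiff ℝ (⊤ : ℕ∞) (fun x => (φ x : ℂ)) := Complex.ofRealCLM.contDiff.comp hφ
    let ψ : SchwartzMap E ℂ := hs.toSchwartzMap hd
    have h1 := congrArg (fun T => T ψ) (Lp.fourier_toTemperedDistribution_eq (hg2.toLp g))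
    simp only [TemperedDistribution.fourier_apply, Lp.toTemperedDistribution_apply] at h1
    have hψ : ∀ x, ψ x = (φ x : ℂ) := fun x => rfl
    have h2 : ∫ x, (𝓕 ψ) x • (hg2.toLp g : E → ℂ) x = ∫ x, (𝓕 ψ) x • g x := by
      apply integral_congr_ae
      filter_upwards [hg2.coeFn_toLp] with x hx
      rw [hx]
    rw [h2] at h1
    have h3 := VectorFourier.integral_fourierIntegral_smul_eq_flip (L := innerₗ E) (μ := volume) (ν := volume)
      Real.continuous_fourierChar (by exact continuous_inner) ψ.integrable hg
    rw [flip_innerₗ] at h3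
    have h4 : ∫ x, (𝓕 ψ) x • g x = ∫ x, ψ x • 𝓕 g x := by
      rw [SchwartzMap.fourier_coe]
      exact h3
    rw [h4] at h1
    simpa [hψ] using h1.symm

open FourierTransform in
/-- The easy half of Plancherel's theorem, for an integrable function. -/
theorem lintegral_enorm_fourier_sq_le {E : Type*} [NormedAddCommGroup E] [InnerProductSpace ℝ E]
    [FiniteDimensional ℝ E] [MeasurableSpace E] [BorelSpace E] {g : E → ℂ}
    (hg : Integrable g) : ∫⁻ x, ‖𝓕 g x‖ₑ ^ 2 ≤ ∫⁻ x, ‖g x‖ₑ ^ 2 := by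
  by_cases h : ∫⁻ x, ‖g x‖ₑ ^ 2 = ∞
  · simp [h]
  have hg2 : MemLp g 2 := by
    refine ⟨hg.1, ?_⟩
    rw [eLpNorm_lt_top_iff_lintegral_rpow_enorm_lt_top (by norm_num) (by norm_num)]
    simpa [lt_top_iff_ne_top] using h
  have key : ∀ f : E → ℂ, ∫⁻ x, ‖f x‖ₑ ^ 2 = eLpNorm f 2 ^ 2 := by
    intro f
    rw [eLpNorm_eq_lintegral_rpow_enorm_toReal (by norm_num) (by norm_num), ← ENNReal.rpow_natCast,
      ← ENNReal.rpow_mul]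
    simp
  rw [key, key, ← eLpNorm_congr_ae (fourier_toLp_ae_eq hg hg2), ← eLpNorm_congr_ae hg2.coeFn_toLp,
    ← Lp.enorm_def, ← Lp.enorm_def, enorm_eq_nnnorm, enorm_eq_nnnorm]
  have := Lp.norm_fourier_eq (hg2.toLp g)
  rw [show ‖(𝓕 (hg2.toLp g) : Lp ℂ 2 (volume : Measure E))‖₊ = ‖hg2.toLp g‖₊ from NNReal.eq this]

/-! ### Contour shift on the fibres of a tube -/

section
variable {E : Type*} [NormedAddCommGroup E] [InnerProductSpace ℝ E]
open FourierTransform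
local notation "⟪" x ", " y "⟫" => inner ℝ x y

/-- The integrand of the Fourier transform of `x ↦ F x y`, continued along the complex line through `y`
in the direction `v`. -/
noncomputable def lineIntegrand (F : E → E → ℂ) (ξ y v : E) (s : ℂ) (x : E) : ℂ :=
  Complex.exp (-(2 * Real.pi * Complex.I) * ((⟪x, ξ⟫ : ℝ) + s * (⟪v, ξ⟫ : ℝ) + Complex.I * (⟪y, ξ⟫ : ℝ))) *
    F (x + s.re • v) (y + s.im • v)


theorem norm_lineIntegrand (F : E → E → ℂ) (ξ y v : E) (s : ℂ) (x : E) :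
    ‖lineIntegrand F ξ y v s x‖ =
      Real.exp (2 * Real.pi * ⟪y + s.im • v, ξ⟫) * ‖F (x + s.re • v) (y + s.im • v)‖ := by
  rw [lineIntegrand, norm_mul, Complex.norm_exp]
  congr 2
  simp [inner_add_left, inner_smul_left]
  ring

variable [FiniteDimensional ℝ E] [MeasurableSpace E] [BorelSpace E]

/-- Translating `x` by `Re s • v` removes the real part of `s`: the integral depends on `Im s` only.
-/
theorem integral_lineIntegrand (F : E → E → ℂ) (ξ y v : E) (s : ℂ) :
    ∫ x, lineIntegrand F ξ y v s x =
      (Real.exp (2 * Real.pi * ⟪y + s.im • v, ξ⟫) : ℂ) * 𝓕 (fun x => F x (y + s.im • v)) ξ := by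
  rw [Real.fourier_eq', ← integral_const_mul,
    ← integral_add_right_eq_self (fun a => _ * _) (s.re • v)]
  refine integral_congr_ae (Filter.Eventually.of_forall fun x => ?_)
  simp only [lineIntegrand, smul_eq_mul]
  rw [← mul_assoc, Complex.ofReal_exp, ← Complex.exp_add]
  congr 2
  have hs := Complex.re_add_im s
  simp only [inner_add_left, inner_smul_left]
  push_cast
  simp only [conj_trivial]
  linear_combination (2 * Real.pi * Complex.I * (⟪v, ξ⟫ : ℝ) : ℂ) * hs -
    (2 * Real.pi * ((⟪y, ξ⟫ : ℝ) + s.im * (⟪v, ξ⟫ : ℝ)) : ℂ) * Complex.I_sq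

/-- This justifies Fubini between the fibre and a side of the contour: the exponential is bounded
along the compact path, and the translation in `x` preserves the `L¹` norm, which is at most `K` on
every fibre. -/
theorem integrable_lineIntegrand_path {Ω : Set E} {F : E → E → ℂ} {K : ℝ≥0∞} (hK : K ≠ ∞)
    (hcont : ContinuousOn (Function.uncurry F) (Set.univ ×ˢ Ω))
    (hint : ∀ y ∈ Ω, ∫⁻ x, ‖F x y‖ₑ ≤ K) (ξ y v : E) {σ : ℝ → ℂ} (hσ : Continuous σ)
    (hσΩ : ∀ a ∈ Set.Icc (0 : ℝ) 1, y + (σ a).im • v ∈ Ω) :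
    Integrable (Function.uncurry fun (x : E) (a : ℝ) => lineIntegrand F ξ y v (σ a) x)
      (volume.prod (volume.restrict (Set.Icc (0 : ℝ) 1))) := by
  have hm : AEStronglyMeasurable (Function.uncurry fun (x : E) (a : ℝ) => lineIntegrand F ξ y v (σ a) x)
      (volume.prod (volume.restrict (Set.Icc (0 : ℝ) 1))) := by
    have : (volume : Measure E).prod (volume.restrict (Set.Icc (0 : ℝ) 1)) =
        (volume.prod volume).restrict (Set.univ ×ˢ Set.Icc (0 : ℝ) 1) := by
      rw [← Measure.prod_restrict, Measure.restrict_univ]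
    rw [this]
    refine ContinuousOn.aestronglyMeasurable ?_ (MeasurableSet.univ.prod measurableSet_Icc)
    refine ContinuousOn.mul (Continuous.continuousOn (by fun_prop)) ?_
    refine hcont.comp (f := fun p : E × ℝ => (p.1 + (σ p.2).re • v, y + (σ p.2).im • v)) ?_ ?_
    · have := Complex.continuous_re.comp hσ
      have := Complex.continuous_im.comp hσ
      exact Continuous.continuousOn (by fun_prop)
    · rintro p ⟨-, hp⟩
      exact ⟨trivial, hσΩ _ hp⟩
  refine ⟨hm, ?_⟩
  have him := Complex.continuous_im.comp hσ
  obtain ⟨M, hM⟩ := (isCompact_Icc (a := (0 : ℝ)) (b := 1)).bddAbove_image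
    (f := fun a => Real.exp (2 * Real.pi * ⟪y + (σ a).im • v, ξ⟫)) (by fun_prop)
  rw [hasFiniteIntegral_iff_enorm, lintegral_prod_symm _ hm.enorm]
  have hb : ∀ a ∈ Set.Icc (0 : ℝ) 1, ∫⁻ x, ‖lineIntegrand F ξ y v (σ a) x‖ₑ ≤ ENNReal.ofReal M * K := by
    intro a ha
    have h1 : ∀ x, ‖lineIntegrand F ξ y v (σ a) x‖ₑ ≤
        ENNReal.ofReal M * ‖F (x + (σ a).re • v) (y + (σ a).im • v)‖ₑ := by
      intro x
      rw [← ofReal_norm, norm_lineIntegrand, ENNReal.ofReal_mul (Real.exp_pos _).le,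
        ofReal_norm]
      gcongr
      exact hM ⟨a, ha, rfl⟩
    refine (lintegral_mono h1).trans ?_
    rw [lintegral_const_mul' _ _ ENNReal.ofReal_ne_top,
      lintegral_add_right_eq_self (fun x => ‖F x (y + (σ a).im • v)‖ₑ)]
    gcongr
    exact hint _ (hσΩ a ha)
  calc _ ≤ ∫⁻ a in Set.Icc (0 : ℝ) 1, ENNReal.ofReal M * K :=
        setLIntegral_mono measurable_const hb
    _ < ∞ := by
        simp
        exact ENNReal.mul_lt_top ENNReal.ofReal_lt_top hK.lt_top

theorem integral_intervalIntegral_lineIntegrand {Ω : Set E} {F : E → E → ℂ} {K : ℝ≥0∞} (hK : K ≠ ∞)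
    (hcont : ContinuousOn (Function.uncurry F) (Set.univ ×ˢ Ω))
    (hint : ∀ y ∈ Ω, ∫⁻ x, ‖F x y‖ₑ ≤ K) (ξ y v : E) {σ : ℝ → ℂ} (hσ : Continuous σ)
    (hσΩ : ∀ a ∈ Set.Icc (0 : ℝ) 1, y + (σ a).im • v ∈ Ω) :
    Integrable (fun x => ∫ a in (0 : ℝ)..1, lineIntegrand F ξ y v (σ a) x) ∧
    ∫ x, ∫ a in (0 : ℝ)..1, lineIntegrand F ξ y v (σ a) x =
      ∫ a in (0 : ℝ)..1, (Real.exp (2 * Real.pi * ⟪y + (σ a).im • v, ξ⟫) : ℂ) *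
        𝓕 (fun x => F x (y + (σ a).im • v)) ξ := by
  have h := integrable_lineIntegrand_path hK hcont hint ξ y v hσ hσΩ
  simp only [intervalIntegral.integral_of_le zero_le_one, ← integral_Icc_eq_integral_Ioc]
  refine ⟨h.integral_prod_left, ?_⟩
  rw [integral_integral_swap h]
  simp only [integral_lineIntegrand]

/-- Contour shift for Fourier transforms on the fibres of a tube domain. -/
theorem exp_mul_fourier_eq_of_tube {Ω : Set E} (hΩ : Convex ℝ Ω) {F : E → E → ℂ} {K : ℝ≥0∞} (hK : K ≠ ∞)
    (hcont : ContinuousOn (Function.uncurry F) (Set.univ ×ˢ Ω))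
    (hhol : ∀ x y v, DifferentiableOn ℂ (fun s : ℂ => F (x + s.re • v) (y + s.im • v))
      {s | y + s.im • v ∈ Ω})
    (hint : ∀ y ∈ Ω, ∫⁻ x, ‖F x y‖ₑ ≤ K) {y y' : E} (hy : y ∈ Ω) (hy' : y' ∈ Ω) (ξ : E) :
    (Real.exp (2 * Real.pi * ⟪y, ξ⟫) : ℂ) * 𝓕 (fun x => F x y) ξ =
      (Real.exp (2 * Real.pi * ⟪y', ξ⟫) : ℂ) * 𝓕 (fun x => F x y') ξ := by
  set v := y' - y with hv
  have hseg : ∀ t ∈ Set.Icc (0 : ℝ) 1, y + t • v ∈ Ω := fun t ht => hΩ.add_smul_sub_mem hy hy' ht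
  -- Cauchy's theorem on the unit square in `s`: as `Im s` runs from 0 to 1, the fibre moves along
  -- the segment from `y` to `y'`, which convexity keeps in `Ω`.
  have hrect : ∀ x, (∫ a in (0 : ℝ)..1, lineIntegrand F ξ y v (a : ℂ) x) -
      (∫ a in (0 : ℝ)..1, lineIntegrand F ξ y v (a + Complex.I) x) +
      Complex.I • (∫ a in (0 : ℝ)..1, lineIntegrand F ξ y v (1 + a * Complex.I) x) -
      Complex.I • (∫ a in (0 : ℝ)..1, lineIntegrand F ξ y v (a * Complex.I) x) = 0 := by
    intro x
    have := Complex.integral_boundary_rect_eq_zero_of_differentiableOn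
      (fun s => lineIntegrand F ξ y v s x) 0 (1 + Complex.I) (by
        refine DifferentiableOn.mul (by fun_prop) ((hhol x y v).mono ?_)
        intro s hs
        have := hs.2
        simp at this
        exact hseg _ this)
    simpa using this
  have h1 := integral_intervalIntegral_lineIntegrand hK hcont hint ξ y v (σ := fun a => (a : ℂ))
    (by fun_prop) (by simp [hy])
  have h2 := integral_intervalIntegral_lineIntegrand hK hcont hint ξ y v
    (σ := fun a => (a : ℂ) + Complex.I) (by fun_prop) (by simp [hv, hy'])
  have h3 := integral_intervalIntegral_lineIntegrand hK hcont hint ξ y v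
    (σ := fun a => 1 + (a : ℂ) * Complex.I) (by fun_prop) (by simpa using hseg)
  have h4 := integral_intervalIntegral_lineIntegrand hK hcont hint ξ y v
    (σ := fun a => (a : ℂ) * Complex.I) (by fun_prop) (by simpa using hseg)
  -- After integration over `x` the two vertical sides coincide, since only `Im s` survives, and
  -- they cancel. What remains equates the horizontal sides, over `y` and over `y'`.
  have h := congrArg (fun φ : E → ℂ => ∫ x, φ x) (funext hrect)
  simp only [integral_zero] at h
  have h' := (integral_sub ((h1.1.sub h2.1).add (h3.1.smul Complex.I)) (h4.1.smul Complex.I)).symm.trans h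
  rw [integral_add' (h1.1.sub h2.1) (h3.1.smul _), integral_sub' h1.1 h2.1] at h'
  simp only [Pi.smul_apply, integral_smul, h1.2, h2.2, h3.2, h4.2] at h'
  simpa [hv, sub_eq_zero] using h'
end

/-! ### Holomorphic functions of several variables -/

section
variable {E : Type*} [NormedAddCommGroup E] [NormedSpace ℂ E]

theorem hasDerivAt_comp_line {F : E → ℂ} {z v : E} {c : ℂ} (h : DifferentiableAt ℂ F (z + c • v)) :
    HasDerivAt (fun ζ : ℂ => F (z + ζ • v)) (fderiv ℂ F (z + c • v) v) c := by
  have h1 : HasDerivAt (fun ζ : ℂ => z + ζ • v) v c := by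
    simpa using ((hasDerivAt_id c).smul_const v).const_add z
  exact h.hasFDerivAt.comp_hasDerivAt c h1

/-- Cauchy's estimate for the derivative of a holomorphic function of several variables. -/
theorem norm_fderiv_le_of_closedBall {F : E → ℂ} {w : E} {ρ M : ℝ} (hρ : 0 < ρ)
    (hd : ∀ z ∈ Metric.closedBall w ρ, DifferentiableAt ℂ F z) (hM : ∀ z ∈ Metric.closedBall w ρ, ‖F z‖ ≤ M) :
    ‖fderiv ℂ F w‖ ≤ M / ρ := by
  have hM0 : 0 ≤ M := (norm_nonneg _).trans (hM w (Metric.mem_closedBall_self hρ.le))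
  refine ContinuousLinearMap.opNorm_le_bound _ (by positivity) fun u => ?_
  rcases eq_or_ne u 0 with rfl | hu
  · simp
  have hu' : 0 < ‖u‖ := norm_pos_iff.2 hu
  -- The radius `ρ / ‖u‖` is the largest for which the disc in direction `u` stays in the ball; the
  -- one-variable Cauchy estimate there is already the operator norm bound.
  have hmem : ∀ ζ ∈ Metric.closedBall (0 : ℂ) (ρ / ‖u‖), w + ζ • u ∈ Metric.closedBall w ρ := by
    intro ζ hζ
    rw [mem_closedBall_zero_iff, le_div_iff₀ hu'] at hζ
    simpa [norm_smul] using hζ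
  have h0 := hasDerivAt_comp_line (F := F) (z := w) (v := u) (c := 0)
    (hd _ (hmem 0 (Metric.mem_closedBall_self (by positivity))))
  have h1 := Complex.norm_deriv_le_of_forall_mem_sphere_norm_le (c := 0) (R := ρ / ‖u‖) (C := M)
    (f := fun ζ : ℂ => F (w + ζ • u)) (by positivity) (by
      refine DifferentiableOn.diffContOnCl fun ζ hζ => ?_
      rw [closure_ball _ (by positivity)] at hζ
      exact (hasDerivAt_comp_line (hd _ (hmem ζ hζ))).differentiableAt.differentiableWithinAt)
    (fun ζ hζ => hM _ (hmem ζ (Metric.sphere_subset_closedBall hζ)))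
  rw [h0.deriv] at h1
  simp only [zero_smul, add_zero] at h1
  rwa [div_div_eq_mul_div, ← div_mul_eq_mul_div] at h1

/-- The directional derivatives of a holomorphic function of several variables are holomorphic. -/
theorem differentiableOn_fderiv_apply_const [FiniteDimensional ℂ E] {F : E → ℂ} {U : Set E} (hU : IsOpen U)
    (hF : DifferentiableOn ℂ F U) (v : E) : DifferentiableOn ℂ (fun z => fderiv ℂ F z v) U := by
  intro z₀ hz₀
  have : ProperSpace E := FiniteDimensional.proper ℂ E
  borelize E
  obtain ⟨r, hr, hrU⟩ := Metric.isOpen_iff.1 hU z₀ hz₀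
  -- Three radii `ρ` fit inside `U`: one for the base point, one for the circle in direction `v`,
  -- one for the Cauchy estimate around a point of that circle.
  set ρ := r / 4 with hρ
  have hρ0 : 0 < ρ := by positivity
  have hsub : Metric.closedBall z₀ (3 * ρ) ⊆ U :=
    (Metric.closedBall_subset_ball (by rw [hρ]; linarith)).trans hrU
  have hda : ∀ z ∈ Metric.closedBall z₀ (3 * ρ), DifferentiableAt ℂ F z := fun z hz =>
    hF.differentiableAt (hU.mem_nhds (hsub hz))
  obtain ⟨M, hM⟩ := (isCompact_closedBall z₀ (3 * ρ)).exists_bound_of_continuousOn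
    (hF.continuousOn.mono hsub)
  set R := ρ / (‖v‖ + 1) with hR
  have hR0 : 0 < R := by positivity
  have hRv : R * ‖v‖ ≤ ρ := by
    rw [hR, div_mul_eq_mul_div, div_le_iff₀ (by positivity)]
    nlinarith [norm_nonneg v]
  have hmem : ∀ z ∈ Metric.ball z₀ ρ, ∀ ζ ∈ Metric.closedBall (0 : ℂ) R,
      z + ζ • v ∈ Metric.closedBall z₀ (2 * ρ) := by
    intro z hz ζ hζ
    rw [Metric.mem_closedBall, dist_eq_norm] at *
    rw [Metric.mem_ball, dist_eq_norm] at hz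
    calc ‖z + ζ • v - z₀‖ = ‖(z - z₀) + ζ • v‖ := by congr 1; abel
      _ ≤ ‖z - z₀‖ + ‖ζ‖ * ‖v‖ := (norm_add_le _ _).trans_eq (by rw [norm_smul])
      _ ≤ ρ + R * ‖v‖ := by
        gcongr
        simpa using hζ
      _ ≤ 2 * ρ := by linarith
  have h23 : Metric.closedBall z₀ (2 * ρ) ⊆ Metric.closedBall z₀ (3 * ρ) :=
    Metric.closedBall_subset_closedBall (by linarith)
  -- Cauchy's formula on a circle of fixed radius expresses the derivative through values of `F`, so
  -- it can be differentiated in `z` under the integral, with the bound `R⁻¹ * (M / ρ)`.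
  have hrep : ∀ z ∈ Metric.ball z₀ ρ, fderiv ℂ F z v =
      (2 * Real.pi * Complex.I : ℂ)⁻¹ • ∫ θ in Set.Ioc 0 (2 * Real.pi),
        deriv (circleMap 0 R) θ • ((circleMap 0 R θ) ^ (-2 : ℤ) • F (z + circleMap 0 R θ • v)) := by
    intro z hz
    have h0 := hasDerivAt_comp_line (F := F) (z := z) (v := v) (c := 0)
      (hda _ (h23 (hmem z hz 0 (Metric.mem_closedBall_self hR0.le))))
    simp only [zero_smul, add_zero] at h0
    have h1 := DiffContOnCl.deriv_eq_smul_circleIntegral (c := 0) (R := R)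
      (f := fun ζ : ℂ => F (z + ζ • v)) hR0 (by
        refine DifferentiableOn.diffContOnCl fun ζ hζ => ?_
        rw [closure_ball _ hR0.ne'] at hζ
        exact (hasDerivAt_comp_line
          (hda _ (h23 (hmem z hz ζ hζ)))).differentiableAt.differentiableWithinAt)
    rw [h0.deriv, circleIntegral, intervalIntegral.integral_of_le (by positivity)] at h1
    rw [eq_inv_smul_iff₀ Complex.two_pi_I_ne_zero, ← h1]
    simp [zpow_neg]
  have hcm : ∀ θ, circleMap 0 R θ ∈ Metric.closedBall (0 : ℂ) R := fun θ =>
    circleMap_mem_closedBall 0 hR0.le θ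
  have hcont : ∀ z ∈ Metric.ball z₀ ρ, Continuous fun θ => F (z + circleMap 0 R θ • v) := by
    intro z hz
    refine (hF.continuousOn.mono (h23.trans hsub)).comp_continuous (by fun_prop) fun θ =>
      hmem z hz _ (hcm θ)
  have hck : Continuous fun θ => deriv (circleMap 0 R) θ * (circleMap 0 R θ) ^ (-2 : ℤ) := by
    simp only [deriv_circleMap]
    refine Continuous.mul (by fun_prop) (Continuous.zpow₀ (by fun_prop) _ fun θ => ?_)
    exact Or.inl (circleMap_ne_center hR0.ne')
  have hnk : ∀ θ, ‖deriv (circleMap 0 R) θ * (circleMap 0 R θ) ^ (-2 : ℤ)‖ = R⁻¹ := by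
    intro θ
    simp [abs_of_pos hR0, pow_two]
    field_simp
  have key : HasFDerivAt (fun z => ∫ θ in Set.Ioc 0 (2 * Real.pi),
        deriv (circleMap 0 R) θ • ((circleMap 0 R θ) ^ (-2 : ℤ) • F (z + circleMap 0 R θ • v)))
      (∫ θ in Set.Ioc 0 (2 * Real.pi), (deriv (circleMap 0 R) θ * (circleMap 0 R θ) ^ (-2 : ℤ)) •
        fderiv ℂ F (z₀ + circleMap 0 R θ • v)) z₀ := by
    simp only [smul_smul]
    refine hasFDerivAt_integral_of_dominated_of_fderiv_le (𝕜 := ℂ)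
      (s := Metric.ball z₀ ρ) (bound := fun _ => R⁻¹ * (M / ρ))
      (F' := fun z θ => (deriv (circleMap 0 R) θ * (circleMap 0 R θ) ^ (-2 : ℤ)) •
        fderiv ℂ F (z + circleMap 0 R θ • v))
      (Metric.ball_mem_nhds _ hρ0) ?_ ?_ ?_ ?_ ?_ ?_
    · filter_upwards [Metric.ball_mem_nhds z₀ hρ0] with z hz
      exact (hck.smul (hcont z hz)).aestronglyMeasurable
    · exact (hck.smul (hcont z₀ (Metric.mem_ball_self hρ0))).integrableOn_Ioc
    · have : Measurable fun θ => fderiv ℂ F (z₀ + circleMap 0 R θ • v) :=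
        (measurable_fderiv ℂ F).comp (Continuous.measurable (by fun_prop))
      have : FiniteDimensional ℂ (E →L[ℂ] ℂ) := inferInstance
      have : ProperSpace (E →L[ℂ] ℂ) := FiniteDimensional.proper ℂ _
      exact hck.aestronglyMeasurable.smul (Measurable.aestronglyMeasurable ‹_›)
    · refine Filter.Eventually.of_forall fun θ z hz => ?_
      rw [norm_smul, hnk]
      gcongr
      have hb : Metric.closedBall (z + circleMap 0 R θ • v) ρ ⊆ Metric.closedBall z₀ (3 * ρ) := by
        refine Metric.closedBall_subset_closedBall' ?_
        have := Metric.mem_closedBall.1 (hmem z hz _ (hcm θ))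
        linarith
      exact norm_fderiv_le_of_closedBall hρ0 (fun w hw => hda w (hb hw)) (fun w hw => hM w (hb hw))
    · exact integrable_const _
    · refine Filter.Eventually.of_forall fun θ z hz => ?_
      have := (hda _ (h23 (hmem z hz _ (hcm θ)))).hasFDerivAt
      have h3 := this.comp z ((hasFDerivAt_id z).add_const (circleMap 0 R θ • v))
      rw [ContinuousLinearMap.comp_id] at h3
      exact h3.const_smul (deriv (circleMap 0 R) θ * (circleMap 0 R θ) ^ (-2 : ℤ))
  refine DifferentiableAt.differentiableWithinAt ?_
  have h2 := key.differentiableAt.const_smul ((2 * Real.pi * Complex.I : ℂ)⁻¹)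
  refine h2.congr_of_eventuallyEq ?_
  filter_upwards [Metric.ball_mem_nhds z₀ hρ0] with z hz
  exact hrep z hz
end

/-! ### The Box operator, the tube and its slice -/

namespace LorentzTube

/-- The partial derivative in `z` is the derivative of the uncurried function in the direction `(0,
e_j)`. The parameter serves to let a cutoff tend to 1: joint holomorphy gives the convergence of all
iterates of `box` at once. -/
theorem differentiableOn_partialD_param {U : Set (ℂ × (Fin 3 → ℂ))} (hU : IsOpen U)
    {H : ℂ → (Fin 3 → ℂ) → ℂ} (hH : DifferentiableOn ℂ (Function.uncurry H) U) (j : Fin 3) :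
    DifferentiableOn ℂ (Function.uncurry fun ε => partialD j (H ε)) U := by
  have h := (differentiableOn_fderiv_apply_const hU hH (0, Pi.single j 1)).const_mul (1 / Complex.I)
  refine h.congr fun p hp => ?_
  have hd : HasFDerivAt (Function.uncurry H) (fderiv ℂ (Function.uncurry H) p) (p.1, p.2) :=
    (hH.differentiableAt (hU.mem_nhds hp)).hasFDerivAt
  have h2 : HasFDerivAt (fun w => Function.uncurry H (p.1, w)) _ p.2 :=
    hd.comp p.2 (hasFDerivAt_prodMk_right p.1 p.2)
  have h3 : fderiv ℂ (H p.1) p.2 = _ := h2.fderiv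
  simp only [Function.uncurry, partialD, h3]
  simp

theorem differentiableOn_box_param {U : Set (ℂ × (Fin 3 → ℂ))} (hU : IsOpen U)
    {H : ℂ → (Fin 3 → ℂ) → ℂ} (hH : DifferentiableOn ℂ (Function.uncurry H) U) :
    DifferentiableOn ℂ (Function.uncurry fun ε => box (H ε)) U := by
  have h := fun j => differentiableOn_partialD_param hU (differentiableOn_partialD_param hU hH j) j
  exact ((h 0).sub (h 1)).sub (h 2)

theorem differentiableOn_iterate_box_param {U : Set (ℂ × (Fin 3 → ℂ))} (hU : IsOpen U)
    {H : ℂ → (Fin 3 → ℂ) → ℂ} (hH : DifferentiableOn ℂ (Function.uncurry H) U) (m : ℕ) :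
    DifferentiableOn ℂ (Function.uncurry fun ε => box^[m] (H ε)) U := by
  induction m with
  | zero => exact hH
  | succ k ih =>
    simp only [Function.iterate_succ_apply']
    exact differentiableOn_box_param hU ih

theorem differentiableOn_iterate_box {T : Set (Fin 3 → ℂ)} (hT : IsOpen T) {F : (Fin 3 → ℂ) → ℂ}
    (hF : DifferentiableOn ℂ F T) (m : ℕ) : DifferentiableOn ℂ (box^[m] F) T := by
  have h := differentiableOn_iterate_box_param (H := fun _ => F) (isOpen_univ.prod hT)
    (hF.comp differentiableOn_snd fun p hp => hp.2) m
  exact h.comp (f := fun z => ((0 : ℂ), z)) (by fun_prop) fun z hz => ⟨trivial, hz⟩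

theorem partialD_eqOn {T : Set (Fin 3 → ℂ)} (hT : IsOpen T) {F G : (Fin 3 → ℂ) → ℂ} (h : Set.EqOn F G T)
    (j : Fin 3) : Set.EqOn (partialD j F) (partialD j G) T := by
  intro z hz
  have : F =ᶠ[nhds z] G := Filter.eventuallyEq_of_mem (hT.mem_nhds hz) h
  simp only [partialD, this.fderiv_eq]

theorem box_eqOn {T : Set (Fin 3 → ℂ)} (hT : IsOpen T) {F G : (Fin 3 → ℂ) → ℂ} (h : Set.EqOn F G T) :
    Set.EqOn (box F) (box G) T := by
  intro z hz
  have h' := fun j => partialD_eqOn hT (partialD_eqOn hT h j) j hz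
  simp only [box, h']

theorem iterate_box_eqOn {T : Set (Fin 3 → ℂ)} (hT : IsOpen T) {F G : (Fin 3 → ℂ) → ℂ}
    (h : Set.EqOn F G T) (m : ℕ) : Set.EqOn (box^[m] F) (box^[m] G) T := by
  induction m with
  | zero => exact h
  | succ k ih =>
    simp only [Function.iterate_succ_apply']
    exact box_eqOn hT ih

theorem isOpen_lorentzCone : IsOpen lorentzCone := by
  have h : Continuous lorentzForm := by
    unfold lorentzForm
    fun_prop
  exact IsOpen.inter (isOpen_lt continuous_const (f := fun _ => (0 : ℝ))
    (g := fun y : Fin 3 → ℝ => y 0 + y 1) (by fun_prop)) (isOpen_lt continuous_const h)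

theorem isOpen_tube : IsOpen tube :=
  isOpen_lorentzCone.preimage (by fun_prop)

theorem isOpen_halfPlane : IsOpen halfPlane :=
  isOpen_lt continuous_const Complex.continuous_im

theorem slice_mem_tube {z : ℂ} (hz : z ∈ halfPlane) : ![z, 0, 0] ∈ tube := by
  have hz : 0 < z.im := hz
  constructor
  · simpa using hz
  · simp [lorentzForm, hz]

theorem continuous_slice : Continuous fun z : ℂ => (![z, 0, 0] : Fin 3 → ℂ) := by
  refine continuous_pi fun j => ?_
  fin_cases j <;> simp [continuous_id', continuous_const]

theorem differentiable_slice : Differentiable ℂ fun z : ℂ => (![z, 0, 0] : Fin 3 → ℂ) := by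
  refine differentiable_pi.2 fun j => ?_
  fin_cases j <;> simp

/-- Continuity on the open tube makes the truncated integrand Borel, as Tonelli and the Dirac
measure require; `(z, 0, 0)` lies in the tube exactly when `z` lies in the half-plane. -/
theorem setLIntegral_prodDirac (μ : Measure ℂ) {φ : (Fin 3 → ℂ) → ℂ} (hφ : ContinuousOn φ tube) :
    ∫⁻ z in tube, ‖φ z‖ₑ ^ 2 ∂(prodDirac μ) = ∫⁻ z in halfPlane, ‖φ ![z, 0, 0]‖ₑ ^ 2 ∂μ := by
  have hcont : Continuous fun p : ℂ × (ℂ × ℂ) => (![p.1, p.2.1, p.2.2] : Fin 3 → ℂ) := by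
    refine continuous_pi fun j => ?_
    fin_cases j <;> simp <;> fun_prop
  have hm : Measurable (tube.indicator fun z => ‖φ z‖ₑ ^ 2) := by
    have h1 : Measurable (tube.indicator φ) := by
      classical
      rw [← Set.piecewise_eq_indicator]
      exact hφ.measurable_piecewise continuousOn_const isOpen_tube.measurableSet
    have : (tube.indicator fun z => ‖φ z‖ₑ ^ 2) = fun z => ‖tube.indicator φ z‖ₑ ^ 2 := by
      ext z
      by_cases hz : z ∈ tube <;> simp [hz]
    rw [this]
    exact h1.enorm.pow_const 2
  have hm' : Measurable fun p : ℂ × (ℂ × ℂ) =>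
      tube.indicator (fun z => ‖φ z‖ₑ ^ 2) ![p.1, p.2.1, p.2.2] := hm.comp hcont.measurable
  rw [← lintegral_indicator isOpen_tube.measurableSet, prodDirac, lintegral_map hm hcont.measurable,
    lintegral_prod _ hm'.aemeasurable,
    ← lintegral_indicator isOpen_halfPlane.measurableSet]
  refine lintegral_congr fun z => ?_
  refine (lintegral_dirac' ((0, 0) : ℂ × ℂ) (hm'.comp (measurable_prodMk_left (x := z)))).trans ?_
  simp only [Function.comp]
  by_cases hz : z ∈ halfPlane
  · simp [hz, slice_mem_tube hz]
  · have : (![z, 0, 0] : Fin 3 → ℂ) ∉ tube := by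
      intro h
      apply hz
      change 0 < z.im
      have := h.1
      simpa using this
    simp [hz, this]

theorem hardyNorm_sq (F : (Fin 3 → ℂ) → ℂ) :
    hardyNorm F ^ 2 = ⨆ y ∈ lorentzCone, ∫⁻ x : Fin 3 → ℝ, ‖F (cpoint x y)‖ₑ ^ 2 := by
  rw [hardyNorm, ← ENNReal.rpow_natCast, ← ENNReal.rpow_mul]
  simp

theorem bergmanNorm_sq (α : ℝ) (G : ℂ → ℂ) :
    bergmanNorm α G ^ 2 = ∫⁻ z in halfPlane, ‖G z‖ₑ ^ 2 * ENNReal.ofReal (z.im ^ α) := by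
  rw [bergmanNorm, ← ENNReal.rpow_natCast, ← ENNReal.rpow_mul]
  simp

/-! ### The dual cone and the Laplace transform on the tube -/

/-- The closure of the Lorentz cone, which is its own dual cone. -/
def closedCone : Set (Fin 3 → ℝ) := {ξ | 0 ≤ ξ 0 ∧ ξ 1 ^ 2 + ξ 2 ^ 2 ≤ ξ 0 ^ 2}

theorem isClosed_closedCone : IsClosed closedCone :=
  IsClosed.inter (isClosed_le (f := fun _ => (0 : ℝ)) (g := fun y : Fin 3 → ℝ => y 0) (by fun_prop) (by fun_prop))
    (isClosed_le (f := fun y : Fin 3 → ℝ => y 1 ^ 2 + y 2 ^ 2) (g := fun y : Fin 3 → ℝ => y 0 ^ 2)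
      (by fun_prop) (by fun_prop))

theorem abs_le_of_mem_closedCone {ξ : Fin 3 → ℝ} (hξ : ξ ∈ closedCone) (j : Fin 3) : |ξ j| ≤ ξ 0 := by
  obtain ⟨h0, h⟩ := hξ
  refine abs_le_of_sq_le_sq ?_ h0
  fin_cases j
  · exact le_rfl
  · exact le_trans (by simp; positivity) h
  · exact le_trans (by simp; positivity) h

/-- The distance, in the direction of the axis, of a point to the boundary of the Lorentz cone. -/
noncomputable def axialDepth (y : Fin 3 → ℝ) : ℝ := y 0 - √(y 1 ^ 2 + y 2 ^ 2)

theorem continuous_axialDepth : Continuous axialDepth := by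
  unfold axialDepth
  fun_prop

theorem mem_lorentzCone_iff {y : Fin 3 → ℝ} : y ∈ lorentzCone ↔ 0 < axialDepth y := by
  have hs := Real.sq_sqrt (by positivity : 0 ≤ y 1 ^ 2 + y 2 ^ 2)
  have hs0 := Real.sqrt_nonneg (y 1 ^ 2 + y 2 ^ 2)
  simp only [lorentzCone, axialDepth, lorentzForm, Set.mem_ofPred_eq]
  constructor
  · rintro ⟨h1, h2⟩
    have h3 : 0 < y 0 := by
      by_contra h
      nlinarith [sq_nonneg (y 2)]
    have := Real.sqrt_lt_sqrt (by positivity) (show y 1 ^ 2 + y 2 ^ 2 < y 0 ^ 2 by linarith)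
    rw [Real.sqrt_sq h3.le] at this
    linarith
  · intro h
    have h2 : y 1 ^ 2 + y 2 ^ 2 < y 0 ^ 2 := by nlinarith
    refine ⟨?_, by linarith⟩
    have := abs_lt_of_sq_lt_sq (show y 1 ^ 2 < y 0 ^ 2 by nlinarith [sq_nonneg (y 2)]) (by linarith)
    linarith [neg_abs_le (y 1)]

/-- Cauchy-Schwarz in the last two coordinates. This is the quantitative form of one half of
self-duality: it turns depth inside the cone into exponential decay in `ξ 0`. -/
theorem axialDepth_mul_le {y ξ : Fin 3 → ℝ} (hξ : ξ ∈ closedCone) :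
    axialDepth y * ξ 0 ≤ ∑ j, ξ j * y j := by
  obtain ⟨h0, h⟩ := hξ
  have hs := Real.sq_sqrt (by positivity : 0 ≤ y 1 ^ 2 + y 2 ^ 2)
  have hs0 := Real.sqrt_nonneg (y 1 ^ 2 + y 2 ^ 2)
  have hcs : (ξ 1 * y 1 + ξ 2 * y 2) ^ 2 ≤ (√(y 1 ^ 2 + y 2 ^ 2) * ξ 0) ^ 2 := by
    rw [mul_pow, hs]
    nlinarith [sq_nonneg (ξ 1 * y 2 - ξ 2 * y 1), sq_nonneg (y 1), sq_nonneg (y 2)]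
  have := abs_le_of_sq_le_sq hcs (by positivity)
  simp only [axialDepth, Fin.sum_univ_three]
  nlinarith [neg_abs_le (ξ 1 * y 1 + ξ 2 * y 2)]

/-- Densities supported in the closed Lorentz cone whose Laplace transform converges on the tube. -/
structure IsConeDensity (f : (Fin 3 → ℝ) → ℂ) : Prop where
  eq_zero : ∀ ξ ∉ closedCone, f ξ = 0
  integrable : ∀ δ : ℝ, 0 < δ → Integrable fun ξ => Real.exp (-δ * ξ 0) • f ξ

/-- The linear form `z ↦ 2πi ∑ ξ_j z_j`. -/
noncomputable def phase (ξ : Fin 3 → ℝ) : (Fin 3 → ℂ) →L[ℂ] ℂ :=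
  ∑ j, (2 * Real.pi * Complex.I * ξ j : ℂ) • ContinuousLinearMap.proj (R := ℂ) (φ := fun _ : Fin 3 => ℂ) j

/-- The Fourier-Laplace transform on the tube. -/
noncomputable def laplace (f : (Fin 3 → ℝ) → ℂ) (z : Fin 3 → ℂ) : ℂ :=
  ∫ ξ, f ξ * Complex.exp (phase ξ z)

theorem phase_apply (ξ : Fin 3 → ℝ) (z : Fin 3 → ℂ) :
    phase ξ z = ∑ j, 2 * Real.pi * Complex.I * ξ j * z j := by
  simp [phase]

theorem continuous_phase : Continuous phase := by
  unfold phase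
  fun_prop

theorem continuous_phase_apply (z : Fin 3 → ℂ) : Continuous fun ξ => phase ξ z := by
  simp only [phase_apply]
  fun_prop

theorem norm_exp_phase (ξ : Fin 3 → ℝ) (z : Fin 3 → ℂ) :
    ‖Complex.exp (phase ξ z)‖ = Real.exp (-(2 * Real.pi) * ∑ j, ξ j * (z j).im) := by
  rw [Complex.norm_exp, phase_apply, Complex.re_sum, Finset.mul_sum]
  congr 1
  refine Finset.sum_congr rfl fun j _ => ?_
  simp
  ring

theorem norm_phase_le {ξ : Fin 3 → ℝ} (hξ : ξ ∈ closedCone) : ‖phase ξ‖ ≤ 6 * Real.pi * ξ 0 := by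
  have hp := Real.pi_pos
  refine ContinuousLinearMap.opNorm_le_bound _ (by have := hξ.1; positivity) fun z => ?_
  rw [phase_apply]
  refine (norm_sum_le _ _).trans ?_
  have : ∀ j ∈ Finset.univ, ‖2 * (Real.pi : ℂ) * Complex.I * ξ j * z j‖ ≤ 2 * Real.pi * ξ 0 * ‖z‖ := by
    intro j _
    simp only [norm_mul, Complex.norm_I, Complex.norm_real, Real.norm_eq_abs, abs_of_pos hp, mul_one,
      Complex.norm_ofNat]
    have h0 := hξ.1
    gcongr
    · exact abs_le_of_mem_closedCone hξ j
    · exact norm_le_pi_norm z j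
  refine (Finset.sum_le_sum this).trans_eq ?_
  simp
  ring

namespace IsConeDensity
variable {f g : (Fin 3 → ℝ) → ℂ}

theorem aestronglyMeasurable (hf : IsConeDensity f) : AEStronglyMeasurable f := by
  have h : f = fun ξ => Real.exp (ξ 0) • (Real.exp (-1 * ξ 0) • f ξ) := by
    ext ξ
    rw [smul_smul, ← Real.exp_add]
    simp
  rw [h]
  exact (Continuous.aestronglyMeasurable (f := fun ξ : Fin 3 → ℝ => Real.exp (ξ 0))
    (by fun_prop)).smul (hf.integrable 1 one_pos).1

theorem sub (hf : IsConeDensity f) (hg : IsConeDensity g) : IsConeDensity fun ξ => f ξ - g ξ := by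
  refine ⟨fun ξ hξ => by simp [hf.eq_zero ξ hξ, hg.eq_zero ξ hξ], fun δ hδ => ?_⟩
  simp only [smul_sub]
  exact (hf.integrable δ hδ).sub (hg.integrable δ hδ)

theorem const_mul (hf : IsConeDensity f) (c : ℂ) : IsConeDensity fun ξ => c * f ξ := by
  refine ⟨fun ξ hξ => by simp [hf.eq_zero ξ hξ], fun δ hδ => ?_⟩
  simpa [mul_left_comm] using (hf.integrable δ hδ).const_mul c

/-- The bound is uniform over all `z` of depth at least `δ`, as needed to dominate difference
quotients near a point. -/
theorem norm_mul_exp_le (hf : IsConeDensity f) {δ : ℝ} {z : Fin 3 → ℂ}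
    (hz : δ ≤ axialDepth fun j => (z j).im) (ξ : Fin 3 → ℝ) :
    ‖f ξ * Complex.exp (phase ξ z)‖ ≤ Real.exp (-(2 * Real.pi * δ) * ξ 0) * ‖f ξ‖ := by
  by_cases hξ : ξ ∈ closedCone
  · rw [norm_mul, norm_exp_phase, mul_comm]
    refine mul_le_mul_of_nonneg_right (Real.exp_le_exp.2 ?_) (norm_nonneg _)
    have h1 := axialDepth_mul_le (y := fun j => (z j).im) hξ
    have h2 := mul_le_mul_of_nonneg_right hz hξ.1
    have h3 := mul_le_mul_of_nonneg_left (h2.trans h1) Real.two_pi_pos.le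
    linarith
  · simp [hf.eq_zero ξ hξ]

theorem integrable_mul_exp (hf : IsConeDensity f) {z : Fin 3 → ℂ} (hz : z ∈ tube) :
    Integrable fun ξ => f ξ * Complex.exp (phase ξ z) := by
  have h0 := (mem_lorentzCone_iff (y := fun j => (z j).im)).1 hz
  have hp := Real.pi_pos
  refine (hf.integrable (2 * Real.pi * axialDepth fun j => (z j).im) (by positivity)).norm.mono
    (hf.aestronglyMeasurable.mul
      (Complex.continuous_exp.comp (continuous_phase_apply z)).aestronglyMeasurable)
    (Filter.Eventually.of_forall fun ξ => ?_)
  refine (hf.norm_mul_exp_le le_rfl ξ).trans_eq ?_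
  rw [norm_norm, norm_smul, Real.norm_eq_abs, abs_of_pos (Real.exp_pos _)]

/-- Half of the exponential rate absorbs the factor `t`, by `s ≤ e^s`. Multiplication by a
coordinate therefore preserves cone densities. -/
theorem mul_exp_le (δ t : ℝ) (hδ : 0 < δ) : t * Real.exp (-δ * t) ≤ 2 / δ * Real.exp (-(δ / 2) * t) := by
  have h1 : Real.exp (-δ * t) = Real.exp (-(δ / 2) * t) * Real.exp (-(δ / 2 * t)) := by
    rw [← Real.exp_add]
    ring_nf
  have h2 : t * Real.exp (-(δ / 2 * t)) ≤ 2 / δ := by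
    have h3 := Real.add_one_le_exp (δ / 2 * t)
    rw [Real.exp_neg, ← div_eq_mul_inv, div_le_div_iff₀ (Real.exp_pos _) hδ]
    linarith
  rw [h1]
  nlinarith [Real.exp_pos (-(δ / 2) * t)]

theorem integrable_coord_mul (hf : IsConeDensity f) {δ : ℝ} (hδ : 0 < δ) :
    Integrable fun ξ => ξ 0 * (Real.exp (-δ * ξ 0) * ‖f ξ‖) := by
  refine ((hf.integrable (δ / 2) (by positivity)).norm.const_mul (2 / δ)).mono
    ((Continuous.aestronglyMeasurable (f := fun ξ : Fin 3 → ℝ => ξ 0) (by fun_prop)).mul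
      ((Continuous.aestronglyMeasurable (f := fun ξ : Fin 3 → ℝ => Real.exp (-δ * ξ 0))
        (by fun_prop)).mul hf.aestronglyMeasurable.norm))
    (Filter.Eventually.of_forall fun ξ => ?_)
  by_cases hξ : ξ ∈ closedCone
  · have h0 := hξ.1
    have h := mul_exp_le δ (ξ 0) hδ
    rw [Real.norm_of_nonneg (by positivity), Real.norm_of_nonneg (by positivity), norm_smul,
      Real.norm_eq_abs, abs_of_pos (Real.exp_pos _), ← mul_assoc, ← mul_assoc]
    gcongr
  · simp [hf.eq_zero ξ hξ]

theorem coord_mul (hf : IsConeDensity f) (j : Fin 3) : IsConeDensity fun ξ => (ξ j : ℂ) * f ξ := by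
  refine ⟨fun ξ hξ => by simp [hf.eq_zero ξ hξ], fun δ hδ => ?_⟩
  refine (hf.integrable_coord_mul hδ).mono
    ((Continuous.aestronglyMeasurable (f := fun ξ : Fin 3 → ℝ => Real.exp (-δ * ξ 0)) (by fun_prop)).smul
      ((Continuous.aestronglyMeasurable (f := fun ξ : Fin 3 → ℝ => (ξ j : ℂ))
        (by fun_prop)).mul hf.aestronglyMeasurable))
    (Filter.Eventually.of_forall fun ξ => ?_)
  by_cases hξ : ξ ∈ closedCone
  · have h0 := hξ.1
    rw [Real.norm_of_nonneg (by positivity), norm_smul, norm_mul, Complex.norm_real,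
      Real.norm_eq_abs, abs_of_pos (Real.exp_pos _), Real.norm_eq_abs, mul_left_comm]
    gcongr
    exact abs_le_of_mem_closedCone hξ j
  · simp [hf.eq_zero ξ hξ]

theorem hasFDerivAt_laplace (hf : IsConeDensity f) {z₀ : Fin 3 → ℂ} (hz₀ : z₀ ∈ tube) :
    Integrable (fun ξ => (f ξ * Complex.exp (phase ξ z₀)) • phase ξ) ∧
    HasFDerivAt (laplace f) (∫ ξ, (f ξ * Complex.exp (phase ξ z₀)) • phase ξ) z₀ := by
  have hp := Real.pi_pos
  have h0 := (mem_lorentzCone_iff (y := fun j => (z₀ j).im)).1 hz₀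
  -- Half the depth of `z₀` remains available on a whole neighbourhood of `z₀`.
  set δ := (axialDepth fun j => (z₀ j).im) / 2 with hδ
  have hδ0 : 0 < δ := by positivity
  have hc : Continuous fun z : Fin 3 → ℂ => axialDepth fun j => (z j).im :=
    continuous_axialDepth.comp (by fun_prop)
  have hs : {z : Fin 3 → ℂ | δ < axialDepth fun j => (z j).im} ∈ nhds z₀ :=
    (isOpen_lt continuous_const hc).mem_nhds (by simp only [Set.mem_ofPred_eq]; linarith)
  have hm : ∀ z : Fin 3 → ℂ, AEStronglyMeasurable fun ξ => f ξ * Complex.exp (phase ξ z) := fun z =>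
    hf.aestronglyMeasurable.mul
      (Complex.continuous_exp.comp (continuous_phase_apply z)).aestronglyMeasurable
  have hb : ∀ ξ, ∀ z ∈ {z : Fin 3 → ℂ | δ < axialDepth fun j => (z j).im},
      ‖(f ξ * Complex.exp (phase ξ z)) • phase ξ‖ ≤
        6 * Real.pi * (ξ 0 * (Real.exp (-(2 * Real.pi * δ) * ξ 0) * ‖f ξ‖)) := by
    intro ξ z hz
    by_cases hξ : ξ ∈ closedCone
    · rw [norm_smul]
      calc _ ≤ (Real.exp (-(2 * Real.pi * δ) * ξ 0) * ‖f ξ‖) * (6 * Real.pi * ξ 0) := by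
            gcongr
            · exact hf.norm_mul_exp_le (le_of_lt hz) ξ
            · exact norm_phase_le hξ
        _ = _ := by ring
    · rw [norm_smul, hf.eq_zero ξ hξ]
      simp
  have hbi := (hf.integrable_coord_mul (δ := 2 * Real.pi * δ) (by positivity)).const_mul (6 * Real.pi)
  have hm' : AEStronglyMeasurable fun ξ => (f ξ * Complex.exp (phase ξ z₀)) • phase ξ :=
    (hm z₀).smul continuous_phase.aestronglyMeasurable
  refine ⟨hbi.mono' hm' (Filter.Eventually.of_forall fun ξ => hb ξ z₀ (mem_of_mem_nhds hs)), ?_⟩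
  refine hasFDerivAt_integral_of_dominated_of_fderiv_le (𝕜 := ℂ) hs
    (F := fun z ξ => f ξ * Complex.exp (phase ξ z))
    (F' := fun z ξ => (f ξ * Complex.exp (phase ξ z)) • phase ξ)
    (Filter.Eventually.of_forall hm) (hf.integrable_mul_exp hz₀) hm'
    (Filter.Eventually.of_forall hb) hbi (Filter.Eventually.of_forall fun ξ z _ => ?_)
  have h := ((phase ξ).hasFDerivAt (x := z)).cexp.const_mul (f ξ)
  rwa [smul_smul] at h

theorem differentiableOn_laplace (hf : IsConeDensity f) : DifferentiableOn ℂ (laplace f) tube :=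
  fun _ hz => (hf.hasFDerivAt_laplace hz).2.differentiableAt.differentiableWithinAt

/-- The factor `1/i` cancels the `i` of `phase`, so the multiplier is real. -/
theorem partialD_laplace (hf : IsConeDensity f) (j : Fin 3) :
    Set.EqOn (partialD j (laplace f)) (laplace fun ξ => 2 * Real.pi * (ξ j * f ξ)) tube := by
  intro z hz
  obtain ⟨hi, hd⟩ := hf.hasFDerivAt_laplace hz
  rw [partialD, hd.fderiv, ContinuousLinearMap.integral_apply hi, ← integral_const_mul, laplace]
  refine integral_congr_ae (Filter.Eventually.of_forall fun ξ => ?_)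
  have : phase ξ (Pi.single j 1) = 2 * Real.pi * Complex.I * ξ j := by
    simp [phase_apply, Pi.single_apply]
  simp only [_root_.smul_apply, this, smul_eq_mul]
  field_simp

theorem laplace_sub (hf : IsConeDensity f) (hg : IsConeDensity g) {z : Fin 3 → ℂ} (hz : z ∈ tube) :
    laplace (fun ξ => f ξ - g ξ) z = laplace f z - laplace g z := by
  simp only [laplace, sub_mul]
  exact integral_sub (hf.integrable_mul_exp hz) (hg.integrable_mul_exp hz)

theorem lorentzForm_mul (hf : IsConeDensity f) :
    IsConeDensity fun ξ => ((2 * Real.pi) ^ 2 * lorentzForm ξ : ℝ) * f ξ := by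
  have h := fun j => ((hf.coord_mul j).coord_mul j)
  have h' := (((h 0).sub (h 1)).sub (h 2)).const_mul ((2 * Real.pi : ℂ) ^ 2)
  convert h' using 2 with ξ
  simp only [lorentzForm]
  push_cast
  ring

theorem box_laplace (hf : IsConeDensity f) :
    Set.EqOn (box (laplace f)) (laplace fun ξ => ((2 * Real.pi) ^ 2 * lorentzForm ξ : ℝ) * f ξ) tube := by
  intro z hz
  have h : ∀ j, partialD j (partialD j (laplace f)) z =
      laplace (fun ξ => 2 * Real.pi * (ξ j * (2 * Real.pi * (ξ j * f ξ)))) z := fun j => by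
    rw [partialD_eqOn isOpen_tube (hf.partialD_laplace j) j hz,
      ((hf.coord_mul j).const_mul (2 * Real.pi)).partialD_laplace j hz]
  have hd := fun j => (((hf.coord_mul j).const_mul (2 * Real.pi)).coord_mul j).const_mul (2 * Real.pi)
  rw [box, h, h, h, ← (hd 0).laplace_sub (hd 1) hz, ← ((hd 0).sub (hd 1)).laplace_sub (hd 2) hz]
  congr 1
  ext ξ
  simp only [lorentzForm]
  push_cast
  ring

theorem lorentzForm_pow_mul (hf : IsConeDensity f) (m : ℕ) :
    IsConeDensity fun ξ => (((2 * Real.pi) ^ 2 * lorentzForm ξ) ^ m : ℝ) * f ξ := by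
  induction m with
  | zero => simpa using hf
  | succ k ih =>
    convert ih.lorentzForm_mul using 2 with ξ
    push_cast
    ring

/-- The identity at each stage holds on the tube only; openness of the tube lets it be
differentiated again. -/
theorem iterate_box_laplace (hf : IsConeDensity f) (m : ℕ) :
    Set.EqOn (box^[m] (laplace f))
      (laplace fun ξ => (((2 * Real.pi) ^ 2 * lorentzForm ξ) ^ m : ℝ) * f ξ) tube := by
  induction m with
  | zero => intro z _; simp
  | succ k ih =>
    intro z hz
    rw [Function.iterate_succ_apply', box_eqOn isOpen_tube ih hz,
      (hf.lorentzForm_pow_mul k).box_laplace hz]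
    congr 1
    ext ξ
    push_cast
    ring

end IsConeDensity
-- Bergman norms on the Fourier side
theorem lintegral_pow_mul_exp (n : ℕ) {r : ℝ} (hr : 0 < r) :
    ∫⁻ y in Set.Ioi (0 : ℝ), ENNReal.ofReal (y ^ n) * ENNReal.ofReal (Real.exp (-(r * y))) =
      ENNReal.ofReal (n.factorial / r ^ (n + 1)) := by
  have h := Real.integral_rpow_mul_exp_neg_mul_Ioi (a := n + 1) (r := r) (by positivity) hr
  rw [Real.Gamma_nat_eq_factorial, add_sub_cancel_right] at h
  have hpos : (0 : ℝ) < n.factorial := by exact_mod_cast n.factorial_pos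
  have h' : ∫ y in Set.Ioi (0 : ℝ), y ^ n * Real.exp (-(r * y)) = n.factorial / r ^ (n + 1) := by
    simp only [Real.rpow_natCast] at h
    rw [h]
    have : ((n : ℝ) + 1) = ((n + 1 : ℕ) : ℝ) := by push_cast; rfl
    rw [this, Real.rpow_natCast, one_div, inv_pow, div_eq_inv_mul]
  rw [← h', ofReal_integral_eq_lintegral_ofReal]
  · refine setLIntegral_congr_fun measurableSet_Ioi fun y hy => ?_
    rw [ENNReal.ofReal_mul (pow_nonneg (le_of_lt hy) n)]
  -- A non-integrable function has integral 0 by convention, whereas the value found above is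
  -- positive.
  · by_contra hc
    rw [integral_undef hc] at h'
    have : 0 < (n.factorial : ℝ) / r ^ (n + 1) := by positivity
    linarith
  · refine (ae_restrict_iff' measurableSet_Ioi).2 (Filter.Eventually.of_forall fun y hy => ?_)
    have : (0 : ℝ) < y := hy
    simp only [Pi.zero_apply]
    positivity

/-- The Fourier-Laplace transform on the half-plane. -/
noncomputable def lineLaplace (g : ℝ → ℂ) (z : ℂ) : ℂ :=
  ∫ t, g t * Complex.exp (2 * Real.pi * Complex.I * t * z)

open FourierTransform in
theorem lintegral_fourierInv_sq_le {E : Type*} [NormedAddCommGroup E] [InnerProductSpace ℝ E]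
    [FiniteDimensional ℝ E] [MeasurableSpace E] [BorelSpace E] {g : E → ℂ}
    (hg : Integrable g) : ∫⁻ x, ‖𝓕⁻ g x‖ₑ ^ 2 ≤ ∫⁻ x, ‖g x‖ₑ ^ 2 := by
  simp only [Real.fourierInv_eq_fourier_neg]
  rw [lintegral_neg_eq_self (fun x => ‖𝓕 g x‖ₑ ^ 2)]
  exact lintegral_enorm_fourier_sq_le hg

open FourierTransform in
theorem lineLaplace_eq_fourierInv (g : ℝ → ℂ) (x y : ℝ) :
    lineLaplace g (x + y * Complex.I) = 𝓕⁻ (fun t => Real.exp (-(2 * Real.pi * y) * t) • g t) x := by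
  rw [Real.fourierInv_eq', lineLaplace]
  refine integral_congr_ae (Filter.Eventually.of_forall fun t => ?_)
  simp only [Complex.real_smul, smul_eq_mul]
  rw [← mul_assoc, Complex.ofReal_exp, ← Complex.exp_add, mul_comm]
  congr 2
  simp
  linear_combination (2 * Real.pi * t * y : ℂ) * Complex.I_sq

theorem enorm_exp_smul_sq (a : ℝ) (w : ℂ) :
    ‖Real.exp a • w‖ₑ ^ 2 = ENNReal.ofReal (Real.exp (2 * a)) * ‖w‖ₑ ^ 2 := by
  rw [enorm_smul, mul_pow, Real.enorm_eq_ofReal (Real.exp_pos _).le, ← ENNReal.ofReal_pow (Real.exp_pos _).le,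
    ← Real.exp_nat_mul]
  norm_num

theorem lintegral_lineLaplace_sq_le {g : ℝ → ℂ} {y : ℝ}
    (hg : Integrable fun t => Real.exp (-(2 * Real.pi * y) * t) • g t) :
    ∫⁻ x : ℝ, ‖lineLaplace g (x + y * Complex.I)‖ₑ ^ 2 ≤
      ∫⁻ t, ENNReal.ofReal (Real.exp (-(4 * Real.pi * t * y))) * ‖g t‖ₑ ^ 2 := by
  simp only [lineLaplace_eq_fourierInv]
  refine (lintegral_fourierInv_sq_le hg).trans_eq ?_
  refine lintegral_congr fun t => ?_
  rw [enorm_exp_smul_sq]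
  congr 4
  ring

/-- Tonelli's theorem for the weight of the Bergman space, on the Fourier side. -/
theorem lintegral_weight_exp (n : ℕ) {g : ℝ → ℂ} (hg : AEStronglyMeasurable g)
    (hg0 : ∀ᵐ t : ℝ, t ≤ 0 → g t = 0) :
    ∫⁻ y in Set.Ioi (0 : ℝ), ENNReal.ofReal (y ^ n) *
        ∫⁻ t, ENNReal.ofReal (Real.exp (-(4 * Real.pi * t * y))) * ‖g t‖ₑ ^ 2 =
      ∫⁻ t, ENNReal.ofReal (n.factorial / (4 * Real.pi * t) ^ (n + 1)) * ‖g t‖ₑ ^ 2 := by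
  have hm : AEMeasurable (fun p : ℝ × ℝ => ENNReal.ofReal (p.1 ^ n) *
      (ENNReal.ofReal (Real.exp (-(4 * Real.pi * p.2 * p.1))) * ‖g p.2‖ₑ ^ 2))
      ((volume.restrict (Set.Ioi (0 : ℝ))).prod volume) := by
    have h1 : Measurable fun p : ℝ × ℝ => ENNReal.ofReal (p.1 ^ n) := by fun_prop
    have h2 : Measurable fun p : ℝ × ℝ => ENNReal.ofReal (Real.exp (-(4 * Real.pi * p.2 * p.1))) := by
      fun_prop
    refine h1.aemeasurable.mul (h2.aemeasurable.mul ?_)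
    exact (hg.enorm.pow_const 2).comp_quasiMeasurePreserving Measure.quasiMeasurePreserving_snd
  calc _ = ∫⁻ y in Set.Ioi (0 : ℝ), ∫⁻ t, ENNReal.ofReal (y ^ n) *
        (ENNReal.ofReal (Real.exp (-(4 * Real.pi * t * y))) * ‖g t‖ₑ ^ 2) := by
        refine lintegral_congr fun y => ?_
        rw [lintegral_const_mul' _ _ ENNReal.ofReal_ne_top]
    _ = ∫⁻ t, ∫⁻ y in Set.Ioi (0 : ℝ), ENNReal.ofReal (y ^ n) *
        (ENNReal.ofReal (Real.exp (-(4 * Real.pi * t * y))) * ‖g t‖ₑ ^ 2) :=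
        lintegral_lintegral_swap hm
    _ = _ := by
      refine lintegral_congr_ae ?_
      filter_upwards [hg0] with t ht
      rcases le_or_gt t 0 with h | h
      · simp [ht h]
      · simp only [← mul_assoc]
        rw [lintegral_mul_const _ (by fun_prop), lintegral_pow_mul_exp n (r := 4 * Real.pi * t)
          (by have := Real.pi_pos; positivity)]

theorem setLIntegral_halfPlane {φ : ℂ → ℝ≥0∞} (hφ : ContinuousOn φ halfPlane) :
    ∫⁻ z in halfPlane, φ z = ∫⁻ y in Set.Ioi (0 : ℝ), ∫⁻ x : ℝ, φ (x + y * Complex.I) := by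
  have hm : Measurable (halfPlane.indicator φ) := by
    classical
    rw [← Set.piecewise_eq_indicator]
    exact hφ.measurable_piecewise continuousOn_const isOpen_halfPlane.measurableSet
  have he : ∀ p : ℝ × ℝ, Complex.measurableEquivRealProd.symm p = p.1 + p.2 * Complex.I := fun p => by
    rw [Complex.measurableEquivRealProd_symm_apply, Complex.mk_eq_add_mul_I]
  have hm' : Measurable fun p : ℝ × ℝ => halfPlane.indicator φ (Complex.measurableEquivRealProd.symm p) :=
    hm.comp (MeasurableEquiv.measurable _)
  rw [← lintegral_indicator isOpen_halfPlane.measurableSet,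
    ← Complex.volume_preserving_equiv_real_prod.symm.lintegral_comp hm, Measure.volume_eq_prod,
    lintegral_prod_symm _ hm'.aemeasurable,
    ← lintegral_indicator measurableSet_Ioi]
  refine lintegral_congr fun y => ?_
  by_cases hy : 0 < y
  · rw [Set.indicator_of_mem (show y ∈ Set.Ioi 0 from hy)]
    refine lintegral_congr fun x => ?_
    rw [he, Set.indicator_of_mem]
    simpa [halfPlane] using hy
  · rw [Set.indicator_of_notMem (show y ∉ Set.Ioi 0 from hy)]
    refine (lintegral_congr fun x => ?_).trans lintegral_zero
    rw [he, Set.indicator_of_notMem]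
    simpa [halfPlane] using hy

theorem bergmanNorm_sq_eq (n : ℕ) {G : ℂ → ℂ} (hG : ContinuousOn G halfPlane) :
    bergmanNorm n G ^ 2 = ∫⁻ y in Set.Ioi (0 : ℝ), ENNReal.ofReal (y ^ n) *
      ∫⁻ x : ℝ, ‖G (x + y * Complex.I)‖ₑ ^ 2 := by
  rw [bergmanNorm_sq]
  simp only [Real.rpow_natCast]
  rw [setLIntegral_halfPlane]
  · refine lintegral_congr fun y => ?_
    rw [← lintegral_const_mul' _ _ ENNReal.ofReal_ne_top]
    refine lintegral_congr fun x => ?_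
    simp [mul_comm]
  · refine ContinuousOn.mono (s := halfPlane) (fun z hz => ?_) subset_rfl
    refine ENNReal.Tendsto.mul ?_ (Or.inr ENNReal.ofReal_ne_top) ?_ (Or.inr (by simp))
    · exact ((ENNReal.continuous_pow 2).comp_continuousOn hG.enorm) z hz
    · exact (ENNReal.continuous_ofReal.comp (Complex.continuous_im.pow n)).continuousWithinAt

/-- Plancherel's inequality on each horizontal line; the Gamma integral then integrates out the
height. -/
theorem bergmanNorm_lineLaplace_sq_le (n : ℕ) {g : ℝ → ℂ} (hg0 : ∀ᵐ t : ℝ, t ≤ 0 → g t = 0)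
    (hg : ∀ y : ℝ, 0 < y → Integrable fun t => Real.exp (-(2 * Real.pi * y) * t) • g t)
    (hgm : AEStronglyMeasurable g)
    {G : ℂ → ℂ} (hGc : ContinuousOn G halfPlane) (hG : ∀ z ∈ halfPlane, G z = lineLaplace g z) :
    bergmanNorm n G ^ 2 ≤ ∫⁻ t, ENNReal.ofReal (n.factorial / (4 * Real.pi * t) ^ (n + 1)) * ‖g t‖ₑ ^ 2 := by
  rw [bergmanNorm_sq_eq n hGc, ← lintegral_weight_exp n hgm hg0]
  refine setLIntegral_mono' measurableSet_Ioi fun y hy => ?_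
  refine mul_le_mul_right ?_ _
  refine le_trans (le_of_eq (lintegral_congr fun x => ?_)) (lintegral_lineLaplace_sq_le (hg y hy))
  rw [hG _ (by simpa [halfPlane] using hy)]

theorem sq_lintegral_mul_le {α : Type*} [MeasurableSpace α] {μ : Measure α} {a b : α → ℝ≥0∞}
    (ha : AEMeasurable a μ) (hb : AEMeasurable b μ) :
    (∫⁻ x, a x * b x ∂μ) ^ 2 ≤ (∫⁻ x, a x ^ 2 ∂μ) * ∫⁻ x, b x ^ 2 ∂μ := by
  have h := ENNReal.lintegral_mul_le_Lp_mul_Lq μ Real.HolderConjugate.two_two ha hb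
  have h2 := pow_le_pow_left' h 2
  rw [mul_pow, ← ENNReal.rpow_natCast, ← ENNReal.rpow_natCast, ← ENNReal.rpow_natCast, ← ENNReal.rpow_mul,
    ← ENNReal.rpow_mul] at h2
  simpa using h2

/-! ### Slices of the cone and marginals -/

/-- The point `(t, η)` of `ℝ³ = ℝ × ℝ²`. -/
def glue (t : ℝ) (η : Fin 2 → ℝ) : Fin 3 → ℝ := ![t, η 0, η 1]

theorem measurePreserving_glue :
    MeasurePreserving (fun p : ℝ × (Fin 2 → ℝ) => glue p.1 p.2) (volume.prod volume) volume := by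
  have h := (volume_preserving_piFinSuccAbove (fun _ : Fin 3 => ℝ) 0).symm
  have he : ⇑(MeasurableEquiv.piFinSuccAbove (fun _ : Fin 3 => ℝ) 0).symm =
      fun p : ℝ × (Fin 2 → ℝ) => glue p.1 p.2 := by
    ext p j
    fin_cases j <;> rfl
  rwa [he] at h

theorem measurableEmbedding_glue : MeasurableEmbedding fun p : ℝ × (Fin 2 → ℝ) => glue p.1 p.2 := by
  have he : ⇑(MeasurableEquiv.piFinSuccAbove (fun _ : Fin 3 => ℝ) 0).symm =
      fun p : ℝ × (Fin 2 → ℝ) => glue p.1 p.2 := by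
    ext p j
    fin_cases j <;> rfl
  rw [← he]
  exact MeasurableEquiv.measurableEmbedding _

theorem measurable_glue (t : ℝ) : Measurable (glue t) :=
  measurePreserving_glue.measurable.comp measurable_prodMk_left

theorem lintegral_eq_lintegral_glue {φ : (Fin 3 → ℝ) → ℝ≥0∞} (hφ : Measurable φ) :
    ∫⁻ ξ, φ ξ = ∫⁻ t, ∫⁻ η, φ (glue t η) := by
  rw [← measurePreserving_glue.lintegral_comp hφ]
  exact lintegral_prod _ (hφ.comp measurePreserving_glue.measurable).aemeasurable

theorem glue_mem_closedCone {t : ℝ} {η : Fin 2 → ℝ} :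
    glue t η ∈ closedCone ↔ 0 ≤ t ∧ η 0 ^ 2 + η 1 ^ 2 ≤ t ^ 2 := Iff.rfl

theorem lorentzForm_glue (t : ℝ) (η : Fin 2 → ℝ) :
    lorentzForm (glue t η) = t ^ 2 - η 0 ^ 2 - η 1 ^ 2 := rfl

theorem lorentzForm_nonneg {ξ : Fin 3 → ℝ} (hξ : ξ ∈ closedCone) : 0 ≤ lorentzForm ξ := by
  have := hξ.2
  simp only [lorentzForm]
  linarith

theorem measurable_lorentzForm : Measurable lorentzForm := by
  unfold lorentzForm
  fun_prop

/-- The `n`-th power of the Lorentz form on the closed cone, and zero elsewhere. -/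
noncomputable def conePow (n : ℕ) : (Fin 3 → ℝ) → ℝ := closedCone.indicator fun ξ => lorentzForm ξ ^ n

theorem measurable_conePow (n : ℕ) : Measurable (conePow n) :=
  (measurable_lorentzForm.pow_const n).indicator isClosed_closedCone.measurableSet

theorem conePow_nonneg (n : ℕ) (ξ : Fin 3 → ℝ) : 0 ≤ conePow n ξ :=
  Set.indicator_nonneg (fun _ hξ => pow_nonneg (lorentzForm_nonneg hξ) n) ξ

theorem conePow_mul_self (n : ℕ) (ξ : Fin 3 → ℝ) : conePow n ξ * conePow n ξ = conePow (2 * n) ξ := by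
  by_cases hξ : ξ ∈ closedCone
  · simp only [conePow, Set.indicator_of_mem hξ]
    ring
  · simp [conePow, hξ]

/-- The integral of the `n`-th power of the Lorentz form over a slice of the cone. -/
noncomputable def coneMoment (n : ℕ) (t : ℝ) : ℝ≥0∞ := ∫⁻ η, ENNReal.ofReal (conePow n (glue t η))

/-- Homogeneity: the integrand has degree `2n` and the slice is a disc of radius `t` in the plane,
which adds 2. For the power `2m` this gives `t^{4m+2}`, the source of the exponent `4m+1` in the
theorem. -/
theorem coneMoment_eq (n : ℕ) {t : ℝ} (ht : 0 < t) :
    coneMoment n t = ENNReal.ofReal (t ^ (2 * n + 2)) * coneMoment n 1 := by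
  have hm : Measurable fun η => ENNReal.ofReal (conePow n (glue t η)) :=
    ((measurable_conePow n).comp (measurable_glue t)).ennreal_ofReal
  have h1 : ∀ η : Fin 2 → ℝ, conePow n (glue t (t • η)) = t ^ (2 * n) * conePow n (glue 1 η) := by
    intro η
    have h2 : glue t (t • η) ∈ closedCone ↔ glue 1 η ∈ closedCone := by
      simp only [glue_mem_closedCone, Pi.smul_apply, smul_eq_mul, ht.le, zero_le_one, true_and, mul_pow,
        ← mul_add, one_pow]
      constructor
      · intro h
        exact le_of_mul_le_mul_left (by linarith) (pow_pos ht 2)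
      · intro h
        nlinarith [pow_pos ht 2]
    by_cases hη : glue 1 η ∈ closedCone
    · rw [conePow, Set.indicator_of_mem (h2.2 hη), Set.indicator_of_mem hη, pow_mul, ← mul_pow]
      congr 1
      simp only [lorentzForm_glue, Pi.smul_apply, smul_eq_mul]
      ring
    · rw [conePow, Set.indicator_of_notMem (fun h => hη (h2.1 h)), Set.indicator_of_notMem hη, mul_zero]
  have h3 : ∫⁻ η : Fin 2 → ℝ, ENNReal.ofReal (conePow n (glue t (t • η))) =
      ENNReal.ofReal ((t ^ 2)⁻¹) * coneMoment n t := by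
    have := lintegral_map (μ := (volume : Measure (Fin 2 → ℝ))) hm (measurable_const_smul t)
    rw [← this, Measure.map_addHaar_smul _ ht.ne', lintegral_smul_measure, coneMoment]
    simp [abs_of_pos ht]
  simp only [h1, ENNReal.ofReal_mul (pow_nonneg ht.le _)] at h3
  rw [lintegral_const_mul' _ _ ENNReal.ofReal_ne_top] at h3
  rw [pow_add, mul_comm (t ^ (2 * n)), ENNReal.ofReal_mul (by positivity), mul_assoc, coneMoment, coneMoment, h3,
    ← mul_assoc, ← ENNReal.ofReal_mul (by positivity), mul_inv_cancel₀ (by positivity)]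
  simp [coneMoment]

theorem coneMoment_one_ne_top (n : ℕ) : coneMoment n 1 ≠ ∞ := by
  have h : ∀ η : Fin 2 → ℝ, ENNReal.ofReal (conePow n (glue 1 η)) ≤
      (Set.Icc (fun _ => -1) (fun _ => 1)).indicator (fun _ => 1) η := by
    intro η
    by_cases hη : glue 1 η ∈ closedCone
    · have hη' : η 0 ^ 2 + η 1 ^ 2 ≤ 1 := by simpa using (glue_mem_closedCone.1 hη).2
      have h0 := abs_le.1 (abs_le_one_iff_mul_self_le_one.2 (show η 0 * η 0 ≤ 1 by nlinarith [sq_nonneg (η 1)]))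
      have h1 := abs_le.1 (abs_le_one_iff_mul_self_le_one.2 (show η 1 * η 1 ≤ 1 by nlinarith [sq_nonneg (η 0)]))
      rw [conePow, Set.indicator_of_mem hη, Set.indicator_of_mem]
      · rw [ENNReal.ofReal_le_one]
        refine pow_le_one₀ (lorentzForm_nonneg hη) ?_
        rw [lorentzForm_glue]
        nlinarith [sq_nonneg (η 0), sq_nonneg (η 1)]
      · constructor <;> intro i <;> fin_cases i <;> simp [h0.1, h0.2, h1.1, h1.2]
    · simp [conePow, hη]
  refine ne_top_of_le_ne_top ?_ (lintegral_mono h)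
  rw [lintegral_indicator measurableSet_Icc, setLIntegral_const, one_mul, Real.volume_Icc_pi]
  exact (ENNReal.prod_lt_top fun i _ => ENNReal.ofReal_lt_top).ne

/-- On the square `|η_j| ≤ 1/2` the form is at least `1/2`. The extension operator divides by this
moment. -/
theorem coneMoment_one_ne_zero (n : ℕ) : coneMoment n 1 ≠ 0 := by
  have h : ∀ η : Fin 2 → ℝ,
      (Set.Icc (fun _ => -(1 / 2)) (fun _ => 1 / 2)).indicator (fun _ => ENNReal.ofReal ((1 / 2) ^ n)) η ≤
        ENNReal.ofReal (conePow n (glue 1 η)) := by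
    intro η
    by_cases hη : η ∈ Set.Icc (fun _ : Fin 2 => -(1 / 2 : ℝ)) (fun _ => 1 / 2)
    · have h0 : η 0 ^ 2 ≤ 1 / 4 := by nlinarith [hη.1 0, hη.2 0]
      have h1 : η 1 ^ 2 ≤ 1 / 4 := by nlinarith [hη.1 1, hη.2 1]
      have hc : glue 1 η ∈ closedCone := glue_mem_closedCone.2 ⟨zero_le_one, by linarith⟩
      rw [conePow, Set.indicator_of_mem hη, Set.indicator_of_mem hc, lorentzForm_glue]
      gcongr
      linarith
    · rw [Set.indicator_of_notMem hη]
      exact zero_le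
  have h2 := lintegral_mono (μ := (volume : Measure (Fin 2 → ℝ))) h
  rw [lintegral_indicator measurableSet_Icc, setLIntegral_const, Real.volume_Icc_pi] at h2
  intro h0
  rw [coneMoment] at h0
  simp [h0] at h2
  norm_num at h2

/-- The integral of a function over the slices of `ℝ³` orthogonal to the axis of the cone. -/
noncomputable def marginal (f : (Fin 3 → ℝ) → ℂ) (t : ℝ) : ℂ := ∫ η, f (glue t η)

theorem marginal_eq_zero {f : (Fin 3 → ℝ) → ℂ} (hf : ∀ ξ ∉ closedCone, f ξ = 0) {t : ℝ} (ht : t < 0) :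
    marginal f t = 0 := by
  have : ∀ η, f (glue t η) = 0 := fun η => hf _ fun h => absurd (glue_mem_closedCone.1 h).1 (not_le.2 ht)
  simp [marginal, this]

theorem ae_marginal_eq_zero {f : (Fin 3 → ℝ) → ℂ} (hf : ∀ ξ ∉ closedCone, f ξ = 0) :
    ∀ᵐ t : ℝ, t ≤ 0 → marginal f t = 0 := by
  filter_upwards [Measure.ae_ne volume (0 : ℝ)] with t ht h
  exact marginal_eq_zero hf (lt_of_le_of_ne h ht)

theorem marginal_mul_comp (f : (Fin 3 → ℝ) → ℂ) (c : ℝ → ℂ) :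
    marginal (fun ξ => c (ξ 0) * f ξ) = fun t => c t * marginal f t := by
  ext t
  exact integral_const_mul (c t) fun η => f (glue t η)

theorem integrable_marginal {f : (Fin 3 → ℝ) → ℂ} (hf : Integrable f) : Integrable (marginal f) :=
  ((measurePreserving_glue.integrable_comp_emb measurableEmbedding_glue).2 hf).integral_prod_left

theorem integral_marginal {f : (Fin 3 → ℝ) → ℂ} (hf : Integrable f) : ∫ t, marginal f t = ∫ ξ, f ξ := by
  rw [← measurePreserving_glue.integral_comp measurableEmbedding_glue]
  exact (integral_prod _ ((measurePreserving_glue.integrable_comp_emb measurableEmbedding_glue).2 hf)).symm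

namespace IsConeDensity
variable {f : (Fin 3 → ℝ) → ℂ}

theorem integrable_exp_smul_marginal (hf : IsConeDensity f) {y : ℝ} (hy : 0 < y) :
    Integrable fun t => Real.exp (-(2 * Real.pi * y) * t) • marginal f t := by
  have h := integrable_marginal (hf.integrable (2 * Real.pi * y) (by have := Real.pi_pos; positivity))
  have h2 := marginal_mul_comp f fun t => Real.exp (-(2 * Real.pi * y) * t)
  simp only [Complex.real_smul] at h ⊢
  rwa [h2] at h

theorem aestronglyMeasurable_marginal (hf : IsConeDensity f) : AEStronglyMeasurable (marginal f) := by
  have h : marginal f = fun t => Real.exp (2 * Real.pi * 1 * t) •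
      (Real.exp (-(2 * Real.pi * 1) * t) • marginal f t) := by
    ext t
    rw [smul_smul, ← Real.exp_add]
    simp
  rw [h]
  exact (Continuous.aestronglyMeasurable (f := fun t : ℝ => Real.exp (2 * Real.pi * 1 * t))
    (by fun_prop)).smul (hf.integrable_exp_smul_marginal one_pos).1

/-- At `(z, 0, 0)` the phase depends on `ξ 0` only, so Fubini integrates the density over the other
two variables first. -/
theorem laplace_slice (hf : IsConeDensity f) {z : ℂ} (hz : z ∈ halfPlane) :
    laplace f ![z, 0, 0] = lineLaplace (marginal f) z := by
  rw [laplace, ← integral_marginal (hf.integrable_mul_exp (slice_mem_tube hz)), lineLaplace]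
  congr 1
  ext t
  have h := congrFun (marginal_mul_comp f fun t => Complex.exp (2 * Real.pi * Complex.I * t * z)) t
  rw [mul_comm, ← h]
  congr 1
  ext ξ
  rw [mul_comm, phase_apply, Fin.sum_univ_three]
  simp

end IsConeDensity

/-- Cauchy-Schwarz on one slice, multiplier against density. Its equality case dictates the form of
`liftDensity`. -/
theorem enorm_marginal_sq_le (m : ℕ) {h : (Fin 3 → ℝ) → ℂ} (hm : Measurable h)
    (h0 : ∀ ξ ∉ closedCone, h ξ = 0) (t : ℝ) :
    ‖marginal (fun ξ => (((2 * Real.pi) ^ 2 * lorentzForm ξ) ^ m : ℝ) * h ξ) t‖ₑ ^ 2 ≤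
      ENNReal.ofReal ((2 * Real.pi) ^ (4 * m)) * coneMoment (2 * m) t * ∫⁻ η, ‖h (glue t η)‖ₑ ^ 2 := by
  have hp := Real.pi_pos
  have h1 : ∀ ξ, ‖((((2 * Real.pi) ^ 2 * lorentzForm ξ) ^ m : ℝ) : ℂ) * h ξ‖ₑ =
      ENNReal.ofReal ((2 * Real.pi) ^ (2 * m) * conePow m ξ) * ‖h ξ‖ₑ := by
    intro ξ
    by_cases hξ : ξ ∈ closedCone
    · have := lorentzForm_nonneg hξ
      rw [enorm_mul, ← ofReal_norm, Complex.norm_real, Real.norm_of_nonneg (by positivity), mul_pow, conePow,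
        Set.indicator_of_mem hξ, ← pow_mul]
    · simp [h0 ξ hξ]
  have h2 : ENNReal.ofReal ((2 * Real.pi) ^ (4 * m)) * coneMoment (2 * m) t =
      ∫⁻ η, ENNReal.ofReal ((2 * Real.pi) ^ (2 * m) * conePow m (glue t η)) ^ 2 := by
    rw [coneMoment, ← lintegral_const_mul' _ _ ENNReal.ofReal_ne_top]
    refine lintegral_congr fun η => ?_
    have := conePow_nonneg m (glue t η)
    rw [← ENNReal.ofReal_pow (by positivity), ← ENNReal.ofReal_mul (by positivity), ← conePow_mul_self]
    congr 1
    ring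
  rw [h2]
  refine le_trans ?_ (sq_lintegral_mul_le ?_ (hm.comp (measurable_glue t)).enorm.aemeasurable)
  · refine pow_le_pow_left' ?_ 2
    refine (enorm_integral_le_lintegral_enorm _).trans_eq ?_
    simp only [h1]
  · exact (((measurable_conePow m).comp (measurable_glue t)).const_mul _).ennreal_ofReal.aemeasurable

end LorentzTube

/-- Fatou's lemma, in the form that removes every regularisation below. -/
theorem lintegral_le_of_tendsto {α : Type*} [MeasurableSpace α] {μ : Measure α} {φ : ℕ → α → ℝ≥0∞}
    {ψ : α → ℝ≥0∞} {C : ℝ≥0∞} (hφ : ∀ n, AEMeasurable (φ n) μ) (hC : ∀ n, ∫⁻ x, φ n x ∂μ ≤ C)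
    (h : ∀ᵐ x ∂μ, Filter.Tendsto (fun n => φ n x) Filter.atTop (nhds (ψ x))) : ∫⁻ x, ψ x ∂μ ≤ C :=
  calc ∫⁻ x, ψ x ∂μ = ∫⁻ x, Filter.liminf (fun n => φ n x) Filter.atTop ∂μ :=
        lintegral_congr_ae (h.mono fun _ hx => hx.liminf_eq.symm)
    _ ≤ Filter.liminf (fun n => ∫⁻ x, φ n x ∂μ) Filter.atTop := lintegral_liminf_le' hφ
    _ ≤ C := Filter.liminf_le_of_frequently_le' (Filter.Frequently.of_forall hC)

/-! ### Paley-Wiener theorem on the tube over a convex cone -/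

section
variable {E : Type*} [NormedAddCommGroup E] [InnerProductSpace ℝ E]
  [FiniteDimensional ℝ E] [MeasurableSpace E] [BorelSpace E]
open FourierTransform
local notation "⟪" x ", " y "⟫" => inner ℝ x y

/-- The Paley-Wiener theorem for functions on the tube over a convex cone that are uniformly integrable
on the fibres. -/
theorem exists_spectrum_of_tube {Ω : Set E} (hΩ : Convex ℝ Ω) (hcone : ∀ s : ℝ, 0 < s → ∀ y ∈ Ω, s • y ∈ Ω)
    (hne : Ω.Nonempty) {F : E → E → ℂ} {K : ℝ≥0∞} (hK : K ≠ ∞)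
    (hcont : ContinuousOn (Function.uncurry F) (Set.univ ×ˢ Ω))
    (hhol : ∀ x y v, DifferentiableOn ℂ (fun s : ℂ => F (x + s.re • v) (y + s.im • v))
      {s | y + s.im • v ∈ Ω})
    (hint : ∀ y ∈ Ω, ∫⁻ x, ‖F x y‖ₑ ≤ K) :
    ∃ H : E → ℂ, Continuous H ∧ (∀ ξ, ‖H ξ‖ ≤ K.toReal) ∧ (∀ ξ, ∀ y ∈ Ω, ⟪y, ξ⟫ < 0 → H ξ = 0) ∧
      (∀ y ∈ Ω, ∫⁻ ξ, ‖Real.exp (-(2 * Real.pi) * ⟪y, ξ⟫) • H ξ‖ₑ ^ 2 ≤ ∫⁻ x, ‖F x y‖ₑ ^ 2) ∧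
      (∀ y ∈ Ω, Integrable (fun ξ => Real.exp (-(2 * Real.pi) * ⟪y, ξ⟫) • H ξ) →
        ∀ x, F x y = 𝓕⁻ (fun ξ => Real.exp (-(2 * Real.pi) * ⟪y, ξ⟫) • H ξ) x) := by
  obtain ⟨y₀, hy₀⟩ := hne
  have hFc : ∀ y ∈ Ω, Continuous fun x => F x y := fun y hy =>
    hcont.comp_continuous (f := fun x => (x, y)) (by fun_prop) fun x => ⟨trivial, hy⟩
  have hFi : ∀ y ∈ Ω, Integrable fun x => F x y := fun y hy =>
    ⟨(hFc y hy).aestronglyMeasurable, (hint y hy).trans_lt hK.lt_top⟩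
  -- By the contour shift, any other base point of `Ω` gives the same function.
  set H : E → ℂ := fun ξ => (Real.exp (2 * Real.pi * ⟪y₀, ξ⟫) : ℂ) * 𝓕 (fun x => F x y₀) ξ with hH
  have hF : ∀ y ∈ Ω, 𝓕 (fun x => F x y) = fun ξ => Real.exp (-(2 * Real.pi) * ⟪y, ξ⟫) • H ξ := by
    intro y hy
    ext ξ
    simp only [hH]
    rw [exp_mul_fourier_eq_of_tube hΩ hK hcont hhol hint hy₀ hy, Complex.real_smul, ← mul_assoc,
      ← Complex.ofReal_mul, ← Real.exp_add]
    simp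
  -- Since `H` does not depend on `y`, this bound may be optimised over the cone: `s • y₀` with `s →
  -- 0` gives `‖H‖ ≤ K`, and `s • y` with `s → ∞` kills `H` wherever `⟪y, ξ⟫ < 0`.
  have hbound : ∀ y ∈ Ω, ∀ ξ, ‖H ξ‖ ≤ Real.exp (2 * Real.pi * ⟪y, ξ⟫) * K.toReal := by
    intro y hy ξ
    have h1 : ‖𝓕 (fun x => F x y) ξ‖ ≤ K.toReal := by
      refine (VectorFourier.norm_fourierIntegral_le_integral_norm _ _ _ _ _).trans ?_
      rw [integral_norm_eq_lintegral_enorm (hFi y hy).1]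
      exact ENNReal.toReal_mono hK (hint y hy)
    rw [hF y hy, norm_smul, Real.norm_of_nonneg (Real.exp_pos _).le] at h1
    calc ‖H ξ‖ = Real.exp (2 * Real.pi * ⟪y, ξ⟫) * (Real.exp (-(2 * Real.pi) * ⟪y, ξ⟫) * ‖H ξ‖) := by
          rw [← mul_assoc, ← Real.exp_add]
          simp
      _ ≤ _ := by gcongr
  refine ⟨H, ?_, ?_, ?_, ?_, ?_⟩
  · have hc : Continuous (𝓕 fun x => F x y₀) :=
      VectorFourier.fourierIntegral_continuous Real.continuous_fourierChar
        (by exact continuous_inner) (hFi y₀ hy₀)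
    exact Continuous.mul (by fun_prop) hc
  · intro ξ
    have hlim : Filter.Tendsto (fun s : ℝ => Real.exp (2 * Real.pi * ⟪s • y₀, ξ⟫) * K.toReal)
        (nhdsWithin 0 (Set.Ioi 0)) (nhds (Real.exp (2 * Real.pi * ⟪(0 : ℝ) • y₀, ξ⟫) * K.toReal)) :=
      (Continuous.tendsto (by fun_prop) 0).mono_left nhdsWithin_le_nhds
    simp only [zero_smul, inner_zero_left, mul_zero, Real.exp_zero, one_mul] at hlim
    exact ge_of_tendsto hlim (Filter.eventually_of_mem self_mem_nhdsWithin fun s hs =>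
      hbound _ (hcone s hs y₀ hy₀) ξ)
  · intro ξ y hy hneg
    have hlim : Filter.Tendsto (fun s : ℝ => Real.exp (2 * Real.pi * ⟪s • y, ξ⟫) * K.toReal)
        Filter.atTop (nhds (0 * K.toReal)) := by
      refine (Real.tendsto_exp_atBot.comp ?_).mul_const _
      have : (fun s : ℝ => 2 * Real.pi * ⟪s • y, ξ⟫) = fun s => (2 * Real.pi * ⟪y, ξ⟫) * s := by
        ext s
        rw [real_inner_smul_left]
        ring
      rw [this]
      exact Filter.tendsto_id.const_mul_atTop_of_neg (by nlinarith [Real.pi_pos])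
    rw [zero_mul] at hlim
    have h0 : ‖H ξ‖ ≤ 0 := ge_of_tendsto hlim ((Filter.eventually_gt_atTop 0).mono fun s hs =>
      hbound _ (hcone s hs y hy) ξ)
    exact norm_le_zero_iff.1 h0
  · intro y hy
    have := lintegral_enorm_fourier_sq_le (hFi y hy)
    rwa [hF y hy] at this
  · intro y hy hi x
    rw [← hF y hy] at hi ⊢
    exact (congrFun (Continuous.fourierInv_fourier_eq (hFc y hy) (hFi y hy) hi) x).symm
end

/-! ### The Hardy space of the Lorentz tube -/

namespace LorentzTube

theorem integrable_exp_neg_mul_abs {c : ℝ} (hc : 0 < c) : Integrable fun x : ℝ => Real.exp (-c * |x|) := by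
  rw [← integrableOn_univ, ← Set.Iic_union_Ioi (a := (0 : ℝ))]
  refine IntegrableOn.union ?_ ?_
  · refine (integrableOn_exp_mul_Iic hc 0).congr_fun (fun x hx => ?_) measurableSet_Iic
    simp only
    rw [abs_of_nonpos hx]
    ring_nf
  · refine (exp_neg_integrableOn_Ioi 0 hc).congr_fun (fun x hx => ?_) measurableSet_Ioi
    simp only
    rw [abs_of_pos hx]

/-- On the closed cone `ξ 0` dominates every `|ξ j|`, so a third of the rate is available for each
coordinate. -/
theorem integrable_indicator_closedCone_exp {δ : ℝ} (hδ : 0 < δ) :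
    Integrable (closedCone.indicator fun ξ => Real.exp (-δ * ξ 0)) := by
  have hi : Integrable fun ξ : Fin 3 → ℝ => ∏ j, Real.exp (-(δ / 3) * |ξ j|) :=
    Integrable.fintype_prod fun _ => integrable_exp_neg_mul_abs (by positivity)
  refine hi.mono' ((Continuous.measurable (by fun_prop)).indicator
    isClosed_closedCone.measurableSet).aestronglyMeasurable (Filter.Eventually.of_forall fun ξ => ?_)
  by_cases hξ : ξ ∈ closedCone
  · rw [Set.indicator_of_mem hξ, Real.norm_of_nonneg (Real.exp_pos _).le, ← Real.exp_sum]
    refine Real.exp_le_exp.2 ?_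
    rw [Fin.sum_univ_three]
    have := fun j => mul_le_mul_of_nonneg_left (abs_le_of_mem_closedCone hξ j) (by positivity : 0 ≤ δ / 3)
    linarith [this 0, this 1, this 2]
  · rw [Set.indicator_of_notMem hξ, norm_zero]
    positivity

theorem isConeDensity_of_bounded {h : (Fin 3 → ℝ) → ℂ} (hm : Measurable h) {K : ℝ}
    (hK : ∀ ξ, ‖h ξ‖ ≤ K) (h0 : ∀ ξ ∉ closedCone, h ξ = 0) : IsConeDensity h := by
  refine ⟨h0, fun δ hδ => ?_⟩
  refine ((integrable_indicator_closedCone_exp hδ).const_mul K).mono'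
    ((Continuous.aestronglyMeasurable (f := fun ξ : Fin 3 → ℝ => Real.exp (-δ * ξ 0)) (by fun_prop)).smul
      hm.aestronglyMeasurable) (Filter.Eventually.of_forall fun ξ => ?_)
  by_cases hξ : ξ ∈ closedCone
  · rw [Set.indicator_of_mem hξ, norm_smul, Real.norm_of_nonneg (Real.exp_pos _).le, mul_comm]
    gcongr
    exact hK ξ
  · simp [h0 ξ hξ, hξ]

/-- The product of the exponential weight and `‖h‖` is at most the sum of their squares, and the
squared weight is integrable on the cone. -/
theorem isConeDensity_of_sq {h : (Fin 3 → ℝ) → ℂ} (hm : Measurable h)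
    (hK : ∫⁻ ξ, ‖h ξ‖ₑ ^ 2 ≠ ∞) (h0 : ∀ ξ ∉ closedCone, h ξ = 0) : IsConeDensity h := by
  refine ⟨h0, fun δ hδ => ?_⟩
  have hi2 : Integrable fun ξ => ‖h ξ‖ ^ 2 := by
    refine ⟨(hm.norm.pow_const 2).aestronglyMeasurable, ?_⟩
    rw [hasFiniteIntegral_iff_enorm]
    refine lt_of_le_of_lt (le_of_eq (lintegral_congr fun ξ => ?_)) hK.lt_top
    rw [enorm_pow, enorm_norm]
  refine ((integrable_indicator_closedCone_exp (δ := 2 * δ) (by positivity)).add hi2).mono'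
    ((Continuous.aestronglyMeasurable (f := fun ξ : Fin 3 → ℝ => Real.exp (-δ * ξ 0)) (by fun_prop)).smul
      hm.aestronglyMeasurable) (Filter.Eventually.of_forall fun ξ => ?_)
  by_cases hξ : ξ ∈ closedCone
  · rw [norm_smul, Real.norm_of_nonneg (Real.exp_pos _).le, Pi.add_apply, Set.indicator_of_mem hξ]
    have : Real.exp (-(2 * δ) * ξ 0) = Real.exp (-δ * ξ 0) ^ 2 := by
      rw [← Real.exp_nat_mul]
      congr 1
      push_cast
      ring
    rw [this]
    nlinarith [sq_nonneg (Real.exp (-δ * ξ 0) - ‖h ξ‖), sq_nonneg (Real.exp (-δ * ξ 0)), sq_nonneg ‖h ξ‖]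
  · simp [h0 ξ hξ, hξ]

/-- `axialDepth` is concave, by the triangle inequality for the Euclidean norm of the last two
coordinates. -/
theorem convex_lorentzCone : Convex ℝ lorentzCone := by
  intro y hy y' hy' a b ha hb hab
  rw [mem_lorentzCone_iff] at *
  set p := √(y 1 ^ 2 + y 2 ^ 2) with hp
  set q := √(y' 1 ^ 2 + y' 2 ^ 2) with hq
  have hp2 := Real.sq_sqrt (by positivity : 0 ≤ y 1 ^ 2 + y 2 ^ 2)
  have hq2 := Real.sq_sqrt (by positivity : 0 ≤ y' 1 ^ 2 + y' 2 ^ 2)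
  have hcs : y 1 * y' 1 + y 2 * y' 2 ≤ p * q := by
    refine (le_abs_self _).trans (abs_le_of_sq_le_sq ?_ (by positivity))
    rw [mul_pow, hp2, hq2]
    nlinarith [sq_nonneg (y 1 * y' 2 - y 2 * y' 1)]
  have hs : √((a • y + b • y') 1 ^ 2 + (a • y + b • y') 2 ^ 2) ≤ a * p + b * q := by
    rw [Real.sqrt_le_left (by positivity)]
    simp only [Pi.add_apply, Pi.smul_apply, smul_eq_mul]
    have := mul_le_mul_of_nonneg_left hcs (mul_nonneg ha hb)
    have he : (a * y 1 + b * y' 1) ^ 2 + (a * y 2 + b * y' 2) ^ 2 = a ^ 2 * (y 1 ^ 2 + y 2 ^ 2) +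
        b ^ 2 * (y' 1 ^ 2 + y' 2 ^ 2) + 2 * (a * b * (y 1 * y' 1 + y 2 * y' 2)) := by ring
    rw [he, ← hp2, ← hq2]
    linarith
  have h1 : 0 ≤ a * (y 0 - p) := mul_nonneg ha hy.le
  have h2 : 0 ≤ b * (y' 0 - q) := mul_nonneg hb hy'.le
  have h3 : 0 < a * (y 0 - p) + b * (y' 0 - q) := by
    rcases ha.eq_or_lt with h | h
    · have : b = 1 := by linarith
      rw [← h, this]
      simp only [axialDepth] at hy'
      linarith
    · have := mul_pos h hy
      simp only [axialDepth] at this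
      linarith
  simp only [axialDepth, Pi.add_apply, Pi.smul_apply, smul_eq_mul] at hs ⊢
  linarith

theorem smul_mem_lorentzCone {s : ℝ} (hs : 0 < s) {y : Fin 3 → ℝ} (hy : y ∈ lorentzCone) :
    s • y ∈ lorentzCone := by
  obtain ⟨h1, h2⟩ := hy
  refine ⟨?_, ?_⟩
  · simp only [Pi.smul_apply, smul_eq_mul, ← mul_add]
    positivity
  · have : lorentzForm (s • y) = s ^ 2 * lorentzForm y := by
      simp only [lorentzForm, Pi.smul_apply, smul_eq_mul]
      ring
    rw [this]
    positivity

theorem axis_mem_lorentzCone {s : ℝ} (hs : 0 < s) : (![s, 0, 0] : Fin 3 → ℝ) ∈ lorentzCone := by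
  simp [lorentzCone, lorentzForm, hs]

/-- A point which is nonnegative on the Lorentz cone belongs to the closed cone. -/
theorem exists_neg_of_notMem_closedCone {ξ : Fin 3 → ℝ} (hξ : ξ ∉ closedCone) :
    ∃ y ∈ lorentzCone, ∑ j, ξ j * y j < 0 := by
  by_contra! h
  refine hξ ⟨?_, ?_⟩
  · have := h _ (axis_mem_lorentzCone one_pos)
    simpa [Fin.sum_univ_three] using this
  · set r := √(ξ 1 ^ 2 + ξ 2 ^ 2) with hr
    have hr2 : r ^ 2 = ξ 1 ^ 2 + ξ 2 ^ 2 := Real.sq_sqrt (by positivity)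
    have hr0 : 0 ≤ r := Real.sqrt_nonneg _
    -- The test vector `(r + δ, -ξ 1, -ξ 2)` has depth `δ` and is the worst direction for `ξ`;
    -- letting `δ → 0` yields `r² ≤ r ξ 0`.
    have hd : ∀ δ : ℝ, 0 < δ → r ^ 2 ≤ (r + δ) * ξ 0 := by
      intro δ hδ
      have hm : (![r + δ, -ξ 1, -ξ 2] : Fin 3 → ℝ) ∈ lorentzCone := by
        rw [mem_lorentzCone_iff]
        simp [axialDepth, ← hr, hδ]
      have := h _ hm
      simp [Fin.sum_univ_three] at this
      nlinarith
    have hlim : Filter.Tendsto (fun δ : ℝ => (r + δ) * ξ 0) (nhdsWithin 0 (Set.Ioi 0))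
        (nhds ((r + 0) * ξ 0)) :=
      (Continuous.tendsto (by fun_prop) 0).mono_left nhdsWithin_le_nhds
    have h1 : r ^ 2 ≤ (r + 0) * ξ 0 :=
      ge_of_tendsto hlim (Filter.eventually_of_mem self_mem_nhdsWithin fun δ hδ => hd δ hδ)
    rw [← hr2]
    rcases hr0.eq_or_lt with h2 | h2
    · rw [← h2, zero_pow two_ne_zero]
      positivity
    · have : r ≤ ξ 0 := by nlinarith
      gcongr

theorem cpoint_mem_tube {x y : Fin 3 → ℝ} : cpoint x y ∈ tube ↔ y ∈ lorentzCone := by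
  have : (fun j => (cpoint x y j).im) = y := by
    ext j
    simp [cpoint]
  rw [tube, Set.mem_ofPred_eq, this]

theorem cpoint_re_im (z : Fin 3 → ℂ) : cpoint (fun j => (z j).re) (fun j => (z j).im) = z := by
  ext j
  simp only [cpoint]
  rw [mul_comm]
  exact Complex.re_add_im (z j)

open FourierTransform in
theorem laplace_cpoint (f : (Fin 3 → ℝ) → ℂ) (x y : EuclideanSpace ℝ (Fin 3)) :
    laplace f (cpoint x.ofLp y.ofLp) =
      𝓕⁻ (fun ξ : EuclideanSpace ℝ (Fin 3) => Real.exp (-(2 * Real.pi) * inner ℝ y ξ) • f ξ.ofLp) x := by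
  rw [Real.fourierInv_eq', laplace,
    ← (EuclideanSpace.volume_preserving_symm_measurableEquiv_toLp (Fin 3)).integral_comp
      (MeasurableEquiv.measurableEmbedding _)]
  refine integral_congr_ae (Filter.Eventually.of_forall fun ξ => ?_)
  simp only [Complex.real_smul, smul_eq_mul, MeasurableEquiv.coe_toLp_symm]
  rw [← mul_assoc, Complex.ofReal_exp, ← Complex.exp_add, mul_comm]
  congr 2
  simp only [phase_apply, cpoint, PiLp.inner_apply, Fin.sum_univ_three]
  simp
  linear_combination (2 * Real.pi * (ξ 0 * y 0 + ξ 1 * y 1 + ξ 2 * y 2) : ℂ) * Complex.I_sq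

/-- Plancherel's inequality on each fibre; the damping factor is at most 1, because `y · ξ ≥ 0` on
the support of the density. -/
theorem hardyNorm_laplace_sq_le {f : (Fin 3 → ℝ) → ℂ} (hf : IsConeDensity f) :
    hardyNorm (laplace f) ^ 2 ≤ ∫⁻ ξ, ‖f ξ‖ₑ ^ 2 := by
  have hmp := EuclideanSpace.volume_preserving_symm_measurableEquiv_toLp (Fin 3)
  have hme := (MeasurableEquiv.toLp 2 (Fin 3 → ℝ)).symm.measurableEmbedding
  rw [hardyNorm_sq]
  refine iSup₂_le fun y₀ hy => ?_
  obtain ⟨y, rfl⟩ : ∃ y : EuclideanSpace ℝ (Fin 3), y.ofLp = y₀ := ⟨WithLp.toLp 2 y₀, rfl⟩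
  rw [← hmp.lintegral_comp_emb hme, ← hmp.lintegral_comp_emb hme]
  simp only [MeasurableEquiv.coe_toLp_symm, laplace_cpoint]
  refine (lintegral_fourierInv_sq_le ?_).trans (lintegral_mono fun ξ => ?_)
  · have h0 := mem_lorentzCone_iff.1 hy
    have hi := hf.integrable_mul_exp (cpoint_mem_tube (x := 0).2 hy)
    have h2 := ((hmp.integrable_comp_emb hme).2 hi)
    refine h2.congr (Filter.Eventually.of_forall fun ξ => ?_)
    simp only [Function.comp, MeasurableEquiv.coe_toLp_symm, Complex.real_smul]
    rw [mul_comm, Complex.ofReal_exp]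
    congr 2
    simp only [phase_apply, cpoint, PiLp.inner_apply, Fin.sum_univ_three]
    simp
    linear_combination (2 * Real.pi * (ξ 0 * y 0 + ξ 1 * y 1 + ξ 2 * y 2) : ℂ) * Complex.I_sq
  · by_cases hξ : ξ.ofLp ∈ closedCone
    · rw [enorm_exp_smul_sq]
      refine mul_le_of_le_one_left zero_le ?_
      rw [ENNReal.ofReal_le_one, Real.exp_le_one_iff]
      have h1 := axialDepth_mul_le (y := y) hξ
      have h2 := mul_nonneg (mem_lorentzCone_iff.1 hy).le hξ.1
      have h3 : inner ℝ y ξ = ∑ j, ξ.ofLp j * y j := by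
        simp [PiLp.inner_apply]
      rw [h3]
      nlinarith [Real.pi_pos]
    · simp [hf.eq_zero _ hξ]

/-- Paley-Wiener representation of a function in the Hardy space which is uniformly integrable on the fibres. -/
theorem exists_eq_laplace {F : (Fin 3 → ℂ) → ℂ} (hF : DifferentiableOn ℂ F tube) {K : ℝ≥0∞} (hK : K ≠ ∞)
    (hint : ∀ y ∈ lorentzCone, ∫⁻ x, ‖F (cpoint x y)‖ₑ ≤ K) :
    ∃ h, Measurable h ∧ IsConeDensity h ∧ Set.EqOn F (laplace h) tube ∧
      ∫⁻ ξ, ‖h ξ‖ₑ ^ 2 ≤ hardyNorm F ^ 2 := by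
  have hmp := EuclideanSpace.volume_preserving_symm_measurableEquiv_toLp (Fin 3)
  have hme := (MeasurableEquiv.toLp 2 (Fin 3 → ℝ)).symm.measurableEmbedding
  set Ω : Set (EuclideanSpace ℝ (Fin 3)) := {y | y.ofLp ∈ lorentzCone} with hΩ
  obtain ⟨H, hHc, hHK, hH0, hH2, hHinv⟩ := exists_spectrum_of_tube (Ω := Ω) (K := K)
    (F := fun x y => F (cpoint x.ofLp y.ofLp))
    (fun y hy y' hy' a b ha hb hab => convex_lorentzCone hy hy' ha hb hab)
    (fun s hs y hy => smul_mem_lorentzCone hs hy)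
    ⟨WithLp.toLp 2 ![1, 0, 0], axis_mem_lorentzCone one_pos⟩ hK
    (by
      refine hF.continuousOn.comp (f := fun p : EuclideanSpace ℝ (Fin 3) × EuclideanSpace ℝ (Fin 3) =>
        cpoint p.1.ofLp p.2.ofLp) ?_ fun p hp => cpoint_mem_tube.2 hp.2
      refine Continuous.continuousOn ?_
      unfold cpoint
      fun_prop)
    (by
      intro x y v
      refine hF.comp (f := fun s : ℂ => cpoint (x + s.re • v).ofLp (y + s.im • v).ofLp) ?_
        fun s hs => cpoint_mem_tube.2 hs
      -- The line is complex affine: it equals `x + iy + s v`.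
      have : (fun s : ℂ => cpoint (x + s.re • v).ofLp (y + s.im • v).ofLp) =
          fun s => fun j => cpoint x.ofLp y.ofLp j + s * (v.ofLp j : ℂ) := by
        ext s j
        simp only [cpoint, WithLp.ofLp_add, WithLp.ofLp_smul, Pi.add_apply, Pi.smul_apply, smul_eq_mul]
        conv_rhs => rw [← Complex.re_add_im s]
        push_cast
        ring
      rw [this]
      fun_prop)
    (by
      intro y hy
      have := hint _ hy
      rwa [← hmp.lintegral_comp_emb hme] at this)
  have hin : ∀ y ξ : EuclideanSpace ℝ (Fin 3), inner ℝ y ξ = ∑ j, ξ.ofLp j * y.ofLp j := fun y ξ => by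
    simp [PiLp.inner_apply]
  set h : (Fin 3 → ℝ) → ℂ := fun ξ => H (WithLp.toLp 2 ξ) with hh
  have hm : Measurable h := hHc.measurable.comp (WithLp.measurable_toLp 2 _)
  -- Boundedness and support suffice here, and the resulting integrability is what Fourier inversion
  -- on each fibre requires.
  have hd : IsConeDensity h := by
    refine isConeDensity_of_bounded hm (fun ξ => hHK _) fun ξ hξ => ?_
    obtain ⟨y, hy, hneg⟩ := exists_neg_of_notMem_closedCone hξ
    refine hH0 (WithLp.toLp 2 ξ) (WithLp.toLp 2 y) hy ?_
    rwa [hin]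
  refine ⟨h, hm, hd, fun z hz => ?_, ?_⟩
  · have hz' : WithLp.toLp 2 (fun j => (z j).im) ∈ Ω := hz
    have h1 := hHinv _ hz' (by
      have hi := hd.integrable_mul_exp (z := cpoint 0 fun j => (z j).im) (cpoint_mem_tube.2 hz)
      have h2 := ((hmp.integrable_comp_emb hme).2 hi)
      refine h2.congr (Filter.Eventually.of_forall fun ξ => ?_)
      simp only [Function.comp, MeasurableEquiv.coe_toLp_symm, Complex.real_smul, hh]
      rw [mul_comm, Complex.ofReal_exp, hin]
      congr 2
      simp only [phase_apply, cpoint, Fin.sum_univ_three]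
      simp
      linear_combination (2 * Real.pi * (ξ 0 * (z 0).im + ξ 1 * (z 1).im + ξ 2 * (z 2).im) : ℂ) * Complex.I_sq)
      (WithLp.toLp 2 fun j => (z j).re)
    have h2 := laplace_cpoint h (WithLp.toLp 2 fun j => (z j).re) (WithLp.toLp 2 fun j => (z j).im)
    rw [WithLp.ofLp_toLp, WithLp.ofLp_toLp, cpoint_re_im] at h1 h2
    rw [h1, h2]
  -- On the fibre over `(1/(n+1), 0, 0)` the damped density has squared norm at most that of `F`;
  -- the damping disappears as `n → ∞`.
  · refine lintegral_le_of_tendsto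
      (φ := fun n ξ => ‖Real.exp (-(2 * Real.pi) * (ξ 0 * (1 / ((n : ℝ) + 1)))) • h ξ‖ₑ ^ 2) ?_ ?_ ?_
    · intro n
      have : Measurable fun ξ : Fin 3 → ℝ => Real.exp (-(2 * Real.pi) * (ξ 0 * (1 / ((n : ℝ) + 1)))) := by
        fun_prop
      exact ((this.smul hm).enorm.pow_const 2).aemeasurable
    · intro n
      have hy : (![1 / ((n : ℝ) + 1), 0, 0] : Fin 3 → ℝ) ∈ lorentzCone :=
        axis_mem_lorentzCone (by positivity)
      have h1 := hH2 (WithLp.toLp 2 ![1 / ((n : ℝ) + 1), 0, 0]) hy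
      rw [← hmp.lintegral_comp_emb hme]
      rw [hardyNorm_sq]
      refine le_trans (le_of_eq (lintegral_congr fun ξ => ?_)) (h1.trans (le_trans (le_of_eq ?_)
        (le_iSup₂ (f := fun y (_ : y ∈ lorentzCone) => ∫⁻ x : Fin 3 → ℝ, ‖F (cpoint x y)‖ₑ ^ 2) _ hy)))
      · rw [hin]
        simp [Fin.sum_univ_three, hh]
      · simp only
        rw [← hmp.lintegral_comp_emb hme]
        rfl
    · refine Filter.Eventually.of_forall fun ξ => ?_
      have h0 := tendsto_one_div_add_atTop_nhds_zero_nat (𝕜 := ℝ)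
      have hc : Continuous fun s : ℝ => ‖Real.exp (-(2 * Real.pi) * (ξ 0 * s)) • h ξ‖ₑ ^ 2 :=
        (ENNReal.continuous_pow 2).comp (Continuous.enorm (by fun_prop))
      have := (hc.tendsto 0).comp h0
      simpa [Function.comp_def] using this

/-! ### Boundedness of the restriction -/

/-- The norm of the restriction of the iterated Box operator, on the Fourier side. -/
noncomputable def restrictionConst (m : ℕ) : ℝ≥0∞ :=
  ENNReal.ofReal ((4 * m + 1).factorial / (4 * Real.pi) ^ (4 * m + 2)) *
    (ENNReal.ofReal ((2 * Real.pi) ^ (4 * m)) * coneMoment (2 * m) 1)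

theorem restrictionConst_ne_top (m : ℕ) : restrictionConst m ≠ ∞ :=
  ENNReal.mul_ne_top ENNReal.ofReal_ne_top (ENNReal.mul_ne_top ENNReal.ofReal_ne_top (coneMoment_one_ne_top _))

theorem bergmanNorm_box_laplace_sq_le (m : ℕ) {h : (Fin 3 → ℝ) → ℂ} (hm : Measurable h)
    (hd : IsConeDensity h) :
    bergmanNorm ((4 * m + 1 : ℕ) : ℝ) (fun z => box^[m] (laplace h) ![z, 0, 0]) ^ 2 ≤
      restrictionConst m * ∫⁻ ξ, ‖h ξ‖ₑ ^ 2 := by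
  have hk := hd.lorentzForm_pow_mul m
  have hdiff := differentiableOn_iterate_box isOpen_tube hd.differentiableOn_laplace m
  refine (bergmanNorm_lineLaplace_sq_le (4 * m + 1) (ae_marginal_eq_zero hk.eq_zero)
    (fun y hy => hk.integrable_exp_smul_marginal hy) hk.aestronglyMeasurable_marginal
    (hdiff.continuousOn.comp continuous_slice.continuousOn fun z hz => slice_mem_tube hz)
    (fun z hz => ?_)).trans ?_
  · rw [Function.comp, hd.iterate_box_laplace m (slice_mem_tube hz), hk.laplace_slice hz]
  · rw [lintegral_eq_lintegral_glue (hm.enorm.pow_const 2),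
      ← lintegral_const_mul' _ _ (restrictionConst_ne_top m)]
    refine lintegral_mono_ae ?_
    filter_upwards [ae_marginal_eq_zero hk.eq_zero] with t ht
    rcases le_or_gt t 0 with h0 | h0
    · rw [ht h0]
      simp
    · refine (mul_le_mul_right (enorm_marginal_sq_le m hm hd.eq_zero t) _).trans_eq ?_
      rw [coneMoment_eq _ h0, restrictionConst, ← mul_assoc]
      congr 1
      have hp := Real.pi_pos
      -- The power `t^{4m+2}` from the slice moment cancels the Bergman weight, leaving a constant.
      have e1 : ((4 * m + 1).factorial : ℝ) / (4 * Real.pi) ^ (4 * m + 2) =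
          (4 * m + 1).factorial / (4 * Real.pi * t) ^ (4 * m + 1 + 1) * t ^ (2 * (2 * m) + 2) := by
        rw [mul_pow (4 * Real.pi) t, show 2 * (2 * m) + 2 = 4 * m + 2 by ring]
        field_simp
      rw [e1, ENNReal.ofReal_mul (by positivity)]
      ring

/-! ### Holomorphic cutoffs and passage to the whole Hardy space -/

/-- A holomorphic function on the tube that cuts off at distance `1 / ε`. -/
noncomputable def cutoff (ε : ℂ) (z : Fin 3 → ℂ) : ℂ :=
  ((1 - Complex.I * ε * z 0) ^ 3 * (1 - Complex.I * ε * (z 0 + z 1)) * (1 - Complex.I * ε * (z 0 + z 2)))⁻¹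

theorem one_add_sq_le_normSq {ε a b : ℝ} (hε : 0 ≤ ε) (hb : 0 ≤ b) :
    1 + ε ^ 2 * a ^ 2 ≤ ‖1 - Complex.I * ε * (a + Complex.I * b)‖ ^ 2 := by
  rw [← Complex.normSq_eq_norm_sq, Complex.normSq_apply]
  simp
  nlinarith [mul_nonneg hε hb]

/-- The forms `z 0`, `z 0 + z 1`, `z 0 + z 2` come from vectors of the dual cone, so each has
nonnegative imaginary part on the tube. Hence each factor `1 - iεw` has real part at least 1, and
its modulus controls `Re w` uniformly in `y`. -/
theorem norm_cutoff_sq_le {ε : ℝ} (hε : 0 ≤ ε) (x : Fin 3 → ℝ) {y : Fin 3 → ℝ} (hy : y ∈ lorentzCone) :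
    ‖cutoff ε (cpoint x y)‖ ^ 2 ≤
      ((1 + ε ^ 2 * x 0 ^ 2) ^ 3 * (1 + ε ^ 2 * (x 0 + x 1) ^ 2) * (1 + ε ^ 2 * (x 0 + x 2) ^ 2))⁻¹ := by
  have h0 := mem_lorentzCone_iff.1 hy
  have hp : ∀ ξ ∈ closedCone, 0 ≤ ∑ j, ξ j * y j := fun ξ hξ =>
    (mul_nonneg h0.le hξ.1).trans (axialDepth_mul_le hξ)
  have p0 : 0 ≤ y 0 := by
    simpa [Fin.sum_univ_three] using hp ![1, 0, 0] (by simp [closedCone])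
  have p1 : 0 ≤ y 0 + y 1 := by
    simpa [Fin.sum_univ_three] using hp ![1, 1, 0] (by simp [closedCone])
  have p2 : 0 ≤ y 0 + y 2 := by
    simpa [Fin.sum_univ_three] using hp ![1, 0, 1] (by simp [closedCone])
  have e0 := one_add_sq_le_normSq (a := x 0) hε p0
  have e1 := one_add_sq_le_normSq (a := x 0 + x 1) hε p1
  have e2 := one_add_sq_le_normSq (a := x 0 + x 2) hε p2
  have q0 : cpoint x y 0 = (x 0 : ℂ) + Complex.I * y 0 := rfl
  have q1 : cpoint x y 0 + cpoint x y 1 = ((x 0 + x 1 : ℝ) : ℂ) + Complex.I * (y 0 + y 1 : ℝ) := by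
    simp only [cpoint]
    push_cast
    ring
  have q2 : cpoint x y 0 + cpoint x y 2 = ((x 0 + x 2 : ℝ) : ℂ) + Complex.I * (y 0 + y 2 : ℝ) := by
    simp only [cpoint]
    push_cast
    ring
  rw [cutoff, norm_inv, inv_pow, norm_mul, norm_mul, norm_pow, mul_pow, mul_pow, ← pow_mul, mul_comm 3 2,
    pow_mul, q1, q2, q0]
  gcongr

theorem norm_cutoff_le_one {ε : ℝ} (hε : 0 ≤ ε) (x : Fin 3 → ℝ) {y : Fin 3 → ℝ} (hy : y ∈ lorentzCone) :
    ‖cutoff ε (cpoint x y)‖ ≤ 1 := by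
  have h := norm_cutoff_sq_le hε x hy
  have h1 : ∀ a : ℝ, 1 ≤ 1 + ε ^ 2 * a ^ 2 := fun a => by nlinarith [sq_nonneg (ε * a)]
  have h2 : 1 ≤ (1 + ε ^ 2 * x 0 ^ 2) ^ 3 * (1 + ε ^ 2 * (x 0 + x 1) ^ 2) * (1 + ε ^ 2 * (x 0 + x 2) ^ 2) :=
    one_le_mul_of_one_le_of_one_le (one_le_mul_of_one_le_of_one_le (one_le_pow₀ (h1 _)) (h1 _)) (h1 _)
  have h3 := h.trans (inv_le_one_of_one_le₀ h2)
  exact (sq_le_one_iff₀ (norm_nonneg _)).1 h3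

/-- This explains the cube in `cutoff`: one factor in `z 0` gives decay in `x 0`, and the other two
convert decay in `x 0 + x j` into decay in `x j`. -/
theorem norm_cutoff_sq_le_prod {ε : ℝ} (hε : 0 ≤ ε) (x : Fin 3 → ℝ) {y : Fin 3 → ℝ} (hy : y ∈ lorentzCone) :
    ‖cutoff ε (cpoint x y)‖ ^ 2 ≤ 4 * ∏ j, (1 + (ε * x j) ^ 2)⁻¹ := by
  refine (norm_cutoff_sq_le hε x hy).trans ?_
  have h : ∀ a b : ℝ, 1 + (ε * b) ^ 2 ≤ 2 * ((1 + ε ^ 2 * a ^ 2) * (1 + ε ^ 2 * (a + b) ^ 2)) := by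
    intro a b
    nlinarith [sq_nonneg (ε * (2 * a + b)), mul_nonneg (mul_nonneg (sq_nonneg ε) (sq_nonneg a))
      (mul_nonneg (sq_nonneg ε) (sq_nonneg (a + b)))]
  rw [Fin.prod_univ_three, ← mul_inv, ← mul_inv, ← inv_inv (4 : ℝ), ← mul_inv]
  refine inv_anti₀ (by positivity) ?_
  have h1 := h (x 0) (x 1)
  have h2 := h (x 0) (x 2)
  calc 4⁻¹ * ((1 + (ε * x 0) ^ 2) * (1 + (ε * x 1) ^ 2) * (1 + (ε * x 2) ^ 2))
      ≤ 4⁻¹ * ((1 + (ε * x 0) ^ 2) * (2 * ((1 + ε ^ 2 * x 0 ^ 2) * (1 + ε ^ 2 * (x 0 + x 1) ^ 2))) *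
        (2 * ((1 + ε ^ 2 * x 0 ^ 2) * (1 + ε ^ 2 * (x 0 + x 2) ^ 2)))) := by gcongr
    _ = _ := by ring

theorem lintegral_cutoff_sq {ε : ℝ} (hε : 0 < ε) :
    ∃ K : ℝ≥0∞, K ≠ ∞ ∧ ∀ y ∈ lorentzCone, ∫⁻ x, ‖cutoff ε (cpoint x y)‖ₑ ^ 2 ≤ K := by
  have hi : Integrable fun x : Fin 3 → ℝ => 4 * ∏ j, (1 + (ε * x j) ^ 2)⁻¹ := by
    refine Integrable.const_mul (Integrable.fintype_prod (f := fun _ (t : ℝ) => (1 + (ε * t) ^ 2)⁻¹)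
      fun _ => ?_) 4
    exact (integrable_inv_one_add_sq).comp_mul_left' hε.ne'
  refine ⟨∫⁻ x : Fin 3 → ℝ, ‖4 * ∏ j, (1 + (ε * x j) ^ 2)⁻¹‖ₑ, hi.2.ne, fun y hy => ?_⟩
  refine lintegral_mono fun x => ?_
  have h := norm_cutoff_sq_le_prod hε.le x hy
  rw [← ofReal_norm, ← ENNReal.ofReal_pow (norm_nonneg _), ← ofReal_norm]
  exact ENNReal.ofReal_le_ofReal (h.trans (le_abs_self _))

/-- The domain of holomorphy of the cutoff functions, with their parameter. -/
def cutoffDomain : Set (ℂ × (Fin 3 → ℂ)) :=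
  {p | p.2 ∈ tube ∧ (1 - Complex.I * p.1 * p.2 0) ^ 3 * (1 - Complex.I * p.1 * (p.2 0 + p.2 1)) *
    (1 - Complex.I * p.1 * (p.2 0 + p.2 2)) ≠ 0}

theorem isOpen_cutoffDomain : IsOpen cutoffDomain :=
  (isOpen_tube.preimage continuous_snd).inter (isOpen_ne_fun (by fun_prop) (by fun_prop))

/-- The parameter of the domain is complex so that joint holomorphy makes sense; `ε = 0`, where the
limit is taken, is included. -/
theorem mem_cutoffDomain {ε : ℝ} (hε : 0 ≤ ε) {z : Fin 3 → ℂ} (hz : z ∈ tube) :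
    ((ε : ℂ), z) ∈ cutoffDomain := by
  refine ⟨hz, ?_⟩
  have h0 := mem_lorentzCone_iff.1 (show (fun j => (z j).im) ∈ lorentzCone from hz)
  have hp : ∀ ξ ∈ closedCone, 0 ≤ ∑ j, ξ j * (z j).im := fun ξ hξ =>
    (mul_nonneg h0.le hξ.1).trans (axialDepth_mul_le hξ)
  have p0 : 0 ≤ (z 0).im := by
    simpa [Fin.sum_univ_three] using hp ![1, 0, 0] (by simp [closedCone])
  have p1 : 0 ≤ (z 0).im + (z 1).im := by
    simpa [Fin.sum_univ_three] using hp ![1, 1, 0] (by simp [closedCone])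
  have p2 : 0 ≤ (z 0).im + (z 2).im := by
    simpa [Fin.sum_univ_three] using hp ![1, 0, 1] (by simp [closedCone])
  have key : ∀ w : ℂ, 0 ≤ w.im → 1 - Complex.I * ε * w ≠ 0 := by
    intro w hw h
    have := congrArg Complex.re h
    simp at this
    nlinarith [mul_nonneg hε hw]
  exact mul_ne_zero (mul_ne_zero (pow_ne_zero 3 (key _ p0)) (key _ p1)) (key _ p2)

theorem differentiableOn_mul_cutoff {F : (Fin 3 → ℂ) → ℂ} (hF : DifferentiableOn ℂ F tube) :
    DifferentiableOn ℂ (Function.uncurry fun ε z => F z * cutoff ε z) cutoffDomain := by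
  refine DifferentiableOn.mul (hF.comp differentiableOn_snd fun p hp => hp.1) ?_
  exact DifferentiableOn.inv (by fun_prop) fun p hp => hp.2

theorem enorm_mul_le_sq_add_sq (a b : ℂ) : ‖a * b‖ₑ ≤ ‖a‖ₑ ^ 2 + ‖b‖ₑ ^ 2 := by
  rw [enorm_mul, pow_two, pow_two]
  rcases le_total ‖a‖ₑ ‖b‖ₑ with h | h
  · exact (mul_le_mul_left h _).trans le_add_self
  · exact (mul_le_mul_right h _).trans le_self_add

/-- The restriction of the iterated Box operator is bounded from the Hardy space to a Bergman space. -/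
theorem bergmanNorm_box_sq_le (m : ℕ) {F : (Fin 3 → ℂ) → ℂ} (hF : MemHardy F) :
    bergmanNorm ((4 * m + 1 : ℕ) : ℝ) (fun z => box^[m] F ![z, 0, 0]) ^ 2 ≤
      restrictionConst m * hardyNorm F ^ 2 := by
  obtain ⟨hdiff, hnorm⟩ := hF
  set H : ℂ → (Fin 3 → ℂ) → ℂ := fun ε z => F z * cutoff ε z with hH
  have hHd := differentiableOn_mul_cutoff hdiff
  have hBox := differentiableOn_iterate_box_param isOpen_cutoffDomain hHd m
  have hle : ∀ y ∈ lorentzCone, ∫⁻ x, ‖F (cpoint x y)‖ₑ ^ 2 ≤ hardyNorm F ^ 2 := fun y hy => by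
    rw [hardyNorm_sq]
    exact le_iSup₂ (f := fun y (_ : y ∈ lorentzCone) => ∫⁻ x : Fin 3 → ℝ, ‖F (cpoint x y)‖ₑ ^ 2) y hy
  have hHdiff : ∀ ε : ℝ, 0 ≤ ε → DifferentiableOn ℂ (H ε) tube := fun ε hε =>
    hHd.comp (f := fun z => ((ε : ℂ), z)) (by fun_prop) fun z hz => mem_cutoffDomain hε hz
  have hHnorm : ∀ ε : ℝ, 0 ≤ ε → hardyNorm (H ε) ^ 2 ≤ hardyNorm F ^ 2 := by
    intro ε hε
    rw [hardyNorm_sq (H ε)]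
    refine iSup₂_le fun y hy => (lintegral_mono fun x => ?_).trans (hle y hy)
    simp only [hH, enorm_mul]
    refine pow_le_pow_left' (mul_le_of_le_one_right zero_le ?_) 2
    rw [← ofReal_norm, ENNReal.ofReal_le_one]
    exact norm_cutoff_le_one hε x hy
  -- For `ε > 0` the function and the cutoff are both square integrable on the fibres, uniformly, so
  -- their product is uniformly integrable and Paley-Wiener applies.
  have hstep : ∀ ε : ℝ, 0 < ε → bergmanNorm ((4 * m + 1 : ℕ) : ℝ) (fun z => box^[m] (H ε) ![z, 0, 0]) ^ 2 ≤
      restrictionConst m * hardyNorm F ^ 2 := by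
    intro ε hε
    obtain ⟨K, hK, hKle⟩ := lintegral_cutoff_sq hε
    obtain ⟨h, hm, hd, heq, hsq⟩ := exists_eq_laplace (hHdiff ε hε.le) (K := hardyNorm F ^ 2 + K)
      (ENNReal.add_ne_top.2 ⟨ENNReal.pow_ne_top hnorm.ne, hK⟩) (by
        intro y hy
        refine (lintegral_mono fun x => enorm_mul_le_sq_add_sq _ _).trans ?_
        rw [lintegral_add_left']
        · exact add_le_add (hle y hy) (hKle y hy)
        · have hc : Continuous fun x => F (cpoint x y) :=
            hdiff.continuousOn.comp_continuous (by unfold cpoint; fun_prop) fun x => cpoint_mem_tube.2 hy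
          exact (hc.measurable.enorm.pow_const 2).aemeasurable)
    have h1 := bergmanNorm_box_laplace_sq_le m hm hd
    have h2 : bergmanNorm ((4 * m + 1 : ℕ) : ℝ) (fun z => box^[m] (H ε) ![z, 0, 0]) ^ 2 =
        bergmanNorm ((4 * m + 1 : ℕ) : ℝ) (fun z => box^[m] (laplace h) ![z, 0, 0]) ^ 2 := by
      rw [bergmanNorm_sq, bergmanNorm_sq]
      refine setLIntegral_congr_fun isOpen_halfPlane.measurableSet fun z hz => ?_
      simp only [iterate_box_eqOn isOpen_tube heq m (slice_mem_tube hz)]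
    rw [h2]
    exact h1.trans (mul_le_mul_right (hsq.trans (hHnorm ε hε.le)) _)
  rw [bergmanNorm_sq]
  refine lintegral_le_of_tendsto
    (φ := fun n z => ‖box^[m] (H ((1 / ((n : ℝ) + 1) : ℝ) : ℂ)) ![z, 0, 0]‖ₑ ^ 2 *
      ENNReal.ofReal (z.im ^ ((4 * m + 1 : ℕ) : ℝ))) ?_ ?_ ?_
  · intro n
    have hc : ContinuousOn (fun z : ℂ => box^[m] (H ((1 / ((n : ℝ) + 1) : ℝ) : ℂ)) ![z, 0, 0]) halfPlane :=
      hBox.continuousOn.comp (f := fun z : ℂ => (((1 / ((n : ℝ) + 1) : ℝ) : ℂ), ![z, 0, 0]))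
        (continuous_const.prodMk continuous_slice).continuousOn
        fun z hz => mem_cutoffDomain (by positivity) (slice_mem_tube hz)
    have hm : Measurable fun z : ℂ => ENNReal.ofReal (z.im ^ ((4 * m + 1 : ℕ) : ℝ)) := by fun_prop
    exact ((hc.aestronglyMeasurable isOpen_halfPlane.measurableSet).enorm.pow_const 2).mul hm.aemeasurable
  · intro n
    have := hstep (1 / ((n : ℝ) + 1)) (by positivity)
    rwa [bergmanNorm_sq] at this
  · refine (ae_restrict_iff' isOpen_halfPlane.measurableSet).2 (Filter.Eventually.of_forall fun z hz => ?_)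
    refine ENNReal.Tendsto.mul_const ?_ (Or.inr ENNReal.ofReal_ne_top)
    have h0 := tendsto_one_div_add_atTop_nhds_zero_nat (𝕜 := ℝ)
    -- Joint continuity at `ε = 0` gives the pointwise limit without computing any derivative of the
    -- cutoff.
    have h1 : ContinuousAt (Function.uncurry fun ε => box^[m] (H ε)) ((0 : ℝ), ![z, 0, 0]) :=
      hBox.continuousOn.continuousAt (isOpen_cutoffDomain.mem_nhds
        (mem_cutoffDomain le_rfl (slice_mem_tube hz)))
    have h2 : Filter.Tendsto (fun n : ℕ => (((1 / ((n : ℝ) + 1) : ℝ) : ℂ), (![z, 0, 0] : Fin 3 → ℂ)))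
        Filter.atTop (nhds (((0 : ℝ) : ℂ), ![z, 0, 0])) :=
      ((Complex.continuous_ofReal.tendsto 0).comp h0).prodMk_nhds tendsto_const_nhds
    have h3 := h1.tendsto.comp h2
    have h4 : H (0 : ℝ) = F := by
      ext z
      simp [hH, cutoff]
    simp only [Function.uncurry, h4] at h3
    exact ((ENNReal.continuous_pow 2).tendsto _).comp (h3.enorm)

theorem isBoxCarleson_of_isBergmanCarleson (m : ℕ) {μ : Measure ℂ}
    (h : IsBergmanCarleson ((4 * m + 1 : ℕ) : ℝ) μ) : IsBoxCarleson m (prodDirac μ) := by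
  obtain ⟨C, hC, hle⟩ := h
  -- The summand 1 only keeps the constant positive.
  refine ⟨C * (restrictionConst m).toNNReal + 1, by positivity, fun F hF => ?_⟩
  have hb := bergmanNorm_box_sq_le m hF
  have hd := differentiableOn_iterate_box isOpen_tube hF.1 m
  rw [setLIntegral_prodDirac μ hd.continuousOn]
  have hmem : MemBergman ((4 * m + 1 : ℕ) : ℝ) fun z => box^[m] F ![z, 0, 0] := by
    refine ⟨hd.comp differentiable_slice.differentiableOn fun z hz => slice_mem_tube hz, ?_⟩
    have h1 := hb.trans_lt (ENNReal.mul_lt_top (restrictionConst_ne_top m).lt_top (ENNReal.pow_lt_top hF.2))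
    exact (ENNReal.pow_lt_top_iff.1 h1).resolve_right two_ne_zero
  refine (hle _ hmem).trans ?_
  calc _ ≤ (C : ℝ≥0∞) * (restrictionConst m * hardyNorm F ^ 2) := by gcongr
    _ ≤ _ := by
      push_cast
      rw [ENNReal.coe_toNNReal (restrictionConst_ne_top m), ← mul_assoc]
      gcongr
      exact le_self_add

/-! ### Regularisation and Paley-Wiener on the half-plane -/

/-- The mean value property on circles, for the square of a holomorphic function. -/
theorem enorm_sq_le_circle {G : ℂ → ℂ} {c : ℂ} {ρ : ℝ} (hρ : 0 < ρ)
    (hG : DifferentiableOn ℂ G (Metric.closedBall c ρ)) :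
    ENNReal.ofReal (2 * Real.pi) * ‖G c‖ₑ ^ 2 ≤
      ∫⁻ θ in Set.Ioo (-Real.pi) Real.pi, ‖G (circleMap c ρ θ)‖ₑ ^ 2 := by
  have hp := Real.pi_pos
  have hd : DiffContOnCl ℂ (fun z => G z ^ 2) (Metric.ball c |ρ|) := by
    rw [abs_of_pos hρ]
    refine DifferentiableOn.diffContOnCl ?_
    rw [closure_ball _ hρ.ne']
    exact hG.pow 2
  have h := hd.circleAverage
  have hper : Function.Periodic (fun θ => G (circleMap c ρ θ) ^ 2) (2 * Real.pi) := fun θ => by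
    simp only [periodic_circleMap c ρ θ]
  -- Circle averages run over `[0, 2π]`, polar coordinates over `(-π, π)`; periodicity reconciles
  -- them.
  have h2 := hper.intervalIntegral_add_eq 0 (-Real.pi)
  rw [zero_add, show -Real.pi + 2 * Real.pi = Real.pi by ring] at h2
  rw [Real.circleAverage, h2, intervalIntegral.integral_of_le (by linarith), integral_Ioc_eq_integral_Ioo] at h
  have h3 : ‖G c‖ₑ ^ 2 ≤ ENNReal.ofReal (2 * Real.pi)⁻¹ *
      ∫⁻ θ in Set.Ioo (-Real.pi) Real.pi, ‖G (circleMap c ρ θ)‖ₑ ^ 2 := by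
    rw [← enorm_pow, ← h, enorm_smul, Real.enorm_eq_ofReal (by positivity)]
    gcongr
    refine (enorm_integral_le_lintegral_enorm _).trans_eq ?_
    simp only [enorm_pow]
  calc _ ≤ ENNReal.ofReal (2 * Real.pi) * (ENNReal.ofReal (2 * Real.pi)⁻¹ *
      ∫⁻ θ in Set.Ioo (-Real.pi) Real.pi, ‖G (circleMap c ρ θ)‖ₑ ^ 2) := by gcongr
    _ = _ := by
      rw [← mul_assoc, ← ENNReal.ofReal_mul (by positivity), mul_inv_cancel₀ (by positivity),
        ENNReal.ofReal_one, one_mul]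

/-- The mean value property on discs, for the square of a holomorphic function. -/
theorem enorm_sq_le_disc {G : ℂ → ℂ} {U : Set ℂ} (hG : DifferentiableOn ℂ G U)
    {c : ℂ} {r : ℝ} (hr : 0 < r) (hc : Metric.ball c r ⊆ U) :
    ENNReal.ofReal (Real.pi * r ^ 2) * ‖G c‖ₑ ^ 2 ≤ ∫⁻ z in Metric.ball c r, ‖G z‖ₑ ^ 2 := by
  have hp := Real.pi_pos
  set φ : ℂ → ℝ≥0∞ := (Metric.ball c r).indicator fun z => ‖G z‖ₑ ^ 2 with hφ
  have h1 : ∫⁻ z in Metric.ball c r, ‖G z‖ₑ ^ 2 = ∫⁻ z, φ (z + c) := by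
    rw [← lintegral_indicator Metric.isOpen_ball.measurableSet, lintegral_add_right_eq_self φ]
  have hm : Measurable φ := by
    have : φ = fun z => ‖(Metric.ball c r).indicator G z‖ₑ ^ 2 := by
      ext z
      by_cases hz : z ∈ Metric.ball c r <;> simp [hφ, hz]
    rw [this]
    have h2 : Measurable ((Metric.ball c r).indicator G) := by
      classical
      rw [← Set.piecewise_eq_indicator]
      exact (hG.continuousOn.mono hc).measurable_piecewise continuousOn_const
        Metric.isOpen_ball.measurableSet
    exact h2.enorm.pow_const 2
  have hcm : ∀ p : ℝ × ℝ, Complex.polarCoord.symm p + c = circleMap c p.1 p.2 := fun p => by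
    rw [Complex.polarCoord_symm_apply, circleMap, add_comm]
    congr 1
    rw [mul_comm (p.2 : ℂ) Complex.I, mul_comm Complex.I, Complex.exp_mul_I, Complex.ofReal_cos,
      Complex.ofReal_sin]
  have hcmm : Measurable fun p : ℝ × ℝ => ENNReal.ofReal p.1 • φ (circleMap c p.1 p.2) := by
    have : Measurable fun p : ℝ × ℝ => circleMap c p.1 p.2 := by
      unfold circleMap
      fun_prop
    exact (ENNReal.measurable_ofReal.comp measurable_fst).mul (hm.comp this)
  have h3 : ∫⁻ ρ in Set.Ioo 0 r, ENNReal.ofReal ρ * (ENNReal.ofReal (2 * Real.pi) * ‖G c‖ₑ ^ 2) ≤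
      ∫⁻ z, φ (z + c) := by
    rw [← Complex.lintegral_comp_polarCoord_symm, polarCoord_target, Measure.volume_eq_prod,
      ← Measure.prod_restrict]
    simp only [hcm]
    rw [lintegral_prod _ hcmm.aemeasurable]
    refine le_trans ?_ (lintegral_mono_set (Set.Ioo_subset_Ioi_self : Set.Ioo 0 r ⊆ Set.Ioi 0))
    refine setLIntegral_mono' measurableSet_Ioo fun ρ hρ => ?_
    simp only [smul_eq_mul]
    rw [lintegral_const_mul' _ _ ENNReal.ofReal_ne_top]
    refine mul_le_mul_right ?_ _
    have hsub : Metric.closedBall c ρ ⊆ Metric.ball c r := Metric.closedBall_subset_ball hρ.2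
    refine (enorm_sq_le_circle hρ.1 (hG.mono (hsub.trans hc))).trans_eq (lintegral_congr fun θ => ?_)
    rw [hφ, Set.indicator_of_mem (hsub (circleMap_mem_closedBall c hρ.1.le θ))]
  rw [h1]
  refine le_trans (le_of_eq ?_) h3
  have h4 : ∫⁻ ρ in Set.Ioo 0 r, ENNReal.ofReal ρ = ENNReal.ofReal (r ^ 2 / 2) := by
    rw [← ofReal_integral_eq_lintegral_ofReal]
    · rw [← integral_Ioc_eq_integral_Ioo, ← intervalIntegral.integral_of_le hr.le, integral_id]
      simp
    · exact (continuous_id.integrableOn_Icc (a := 0) (b := r)).mono_set Set.Ioo_subset_Icc_self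
    · exact (ae_restrict_iff' measurableSet_Ioo).2 (Filter.Eventually.of_forall fun ρ hρ => hρ.1.le)
  rw [lintegral_mul_const _ ENNReal.measurable_ofReal, h4, ← mul_assoc, ← ENNReal.ofReal_mul (by positivity)]
  congr 2
  ring

/-- Functions in a Bergman space are bounded away from the real axis. -/
theorem exists_bound_of_bergman (n : ℕ) {G : ℂ → ℂ} (hG : MemBergman n G) {ε : ℝ} (hε : 0 < ε) :
    ∃ B : ℝ, ∀ z : ℂ, ε ≤ z.im → ‖G z‖ ≤ B := by
  obtain ⟨hd, hn⟩ := hG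
  have hp := Real.pi_pos
  set N := bergmanNorm n G ^ 2 with hN
  have hNt : N ≠ ∞ := ENNReal.pow_ne_top hn.ne
  have hpos : 0 < Real.pi * (ε / 2) ^ 2 * (ε / 2) ^ n := by positivity
  -- The disc of radius `ε/2` about `z` stays at height at least `ε/2`, where the weight is at least
  -- `(ε/2)^n`.
  have key : ∀ z : ℂ, ε ≤ z.im → ENNReal.ofReal (Real.pi * (ε / 2) ^ 2 * (ε / 2) ^ n) * ‖G z‖ₑ ^ 2 ≤ N := by
    intro z hz
    have him : ∀ w ∈ Metric.ball z (ε / 2), ε / 2 ≤ w.im := by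
      intro w hw
      have h1 := (Complex.abs_im_le_norm (w - z)).trans_lt (by simpa [dist_eq_norm] using hw)
      rw [Complex.sub_im] at h1
      linarith [(abs_lt.1 h1).1]
    have hsub : Metric.ball z (ε / 2) ⊆ halfPlane := fun w hw => lt_of_lt_of_le (by positivity) (him w hw)
    have h1 := enorm_sq_le_disc hd (by positivity) hsub
    rw [mul_comm (Real.pi * _), ENNReal.ofReal_mul (by positivity), mul_assoc]
    refine (mul_le_mul_right h1 _).trans ?_
    rw [← lintegral_const_mul' _ _ ENNReal.ofReal_ne_top, hN, bergmanNorm_sq]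
    refine le_trans (setLIntegral_mono' Metric.isOpen_ball.measurableSet fun w hw => ?_) (lintegral_mono_set hsub)
    rw [mul_comm, Real.rpow_natCast]
    gcongr
    exact him w hw
  refine ⟨√((N / ENNReal.ofReal (Real.pi * (ε / 2) ^ 2 * (ε / 2) ^ n)).toReal), fun z hz => ?_⟩
  refine Real.le_sqrt_of_sq_le ?_
  have h1 := key z hz
  rw [mul_comm] at h1
  have h2 := (ENNReal.le_div_iff_mul_le (Or.inl (ENNReal.ofReal_pos.2 hpos).ne')
    (Or.inl ENNReal.ofReal_ne_top)).2 h1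
  have h3 := ENNReal.toReal_mono (ENNReal.div_ne_top hNt (ENNReal.ofReal_pos.2 hpos).ne') h2
  simpa using h3

/-- A regularisation of a function on the half-plane: translate, and cut off at infinity. -/
noncomputable def lineRegularize (ε : ℝ) (G : ℂ → ℂ) (z : ℂ) : ℂ :=
  G (z + ε * Complex.I) * ((1 - Complex.I * ε * z) ^ 2)⁻¹

theorem one_add_sq_le_norm_sq_of_halfPlane {ε : ℝ} (hε : 0 ≤ ε) {z : ℂ} (hz : z ∈ halfPlane) :
    1 + (ε * z.re) ^ 2 ≤ ‖(1 - Complex.I * ε * z) ^ 2‖ := by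
  have h := one_add_sq_le_normSq (a := z.re) hε (le_of_lt hz : 0 ≤ z.im)
  rw [mul_comm Complex.I (z.im : ℂ), Complex.re_add_im, ← norm_pow] at h
  rwa [mul_pow]

theorem add_mem_halfPlane {ε : ℝ} (hε : 0 ≤ ε) {z : ℂ} (hz : z ∈ halfPlane) :
    z + ε * Complex.I ∈ halfPlane := by
  have : 0 < z.im := hz
  simp only [halfPlane, Set.mem_ofPred_eq, Complex.add_im, Complex.mul_im, Complex.ofReal_re, Complex.I_im]
  simp
  linarith

theorem differentiableOn_lineRegularize {ε : ℝ} (hε : 0 ≤ ε) {G : ℂ → ℂ} (hG : DifferentiableOn ℂ G halfPlane) :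
    DifferentiableOn ℂ (lineRegularize ε G) halfPlane := by
  refine DifferentiableOn.mul (hG.comp (by fun_prop) fun z hz => add_mem_halfPlane hε hz)
    (DifferentiableOn.inv (by fun_prop) fun z hz h => ?_)
  have := one_add_sq_le_norm_sq_of_halfPlane hε hz
  rw [h, norm_zero] at this
  nlinarith [sq_nonneg (ε * z.re)]

theorem norm_lineRegularize_le {ε : ℝ} (hε : 0 ≤ ε) (G : ℂ → ℂ) {z : ℂ} (hz : z ∈ halfPlane) :
    ‖lineRegularize ε G z‖ ≤ ‖G (z + ε * Complex.I)‖ * (1 + (ε * z.re) ^ 2)⁻¹ := by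
  rw [lineRegularize, norm_mul, norm_inv]
  gcongr
  exact one_add_sq_le_norm_sq_of_halfPlane hε hz

/-- The weight `y^n` is nondecreasing in the height, so an upward translation does not increase the
norm; the cutoff has modulus at most 1. -/
theorem bergmanNorm_lineRegularize_sq_le (n : ℕ) {ε : ℝ} (hε : 0 ≤ ε) (G : ℂ → ℂ) :
    bergmanNorm n (lineRegularize ε G) ^ 2 ≤ bergmanNorm n G ^ 2 := by
  simp only [bergmanNorm_sq, Real.rpow_natCast]
  rw [← lintegral_indicator isOpen_halfPlane.measurableSet, ← lintegral_indicator isOpen_halfPlane.measurableSet,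
    ← lintegral_add_right_eq_self (halfPlane.indicator fun z => ‖G z‖ₑ ^ 2 * ENNReal.ofReal (z.im ^ n))
      (ε * Complex.I)]
  refine lintegral_mono fun z => ?_
  by_cases hz : z ∈ halfPlane
  · have hz' : 0 < z.im := hz
    rw [Set.indicator_of_mem hz, Set.indicator_of_mem (add_mem_halfPlane hε hz)]
    have h1 : ‖lineRegularize ε G z‖ ≤ ‖G (z + ε * Complex.I)‖ := by
      refine (norm_lineRegularize_le hε G hz).trans (mul_le_of_le_one_right (norm_nonneg _) ?_)
      exact inv_le_one_of_one_le₀ (by nlinarith [sq_nonneg (ε * z.re)])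
    have h2 : ‖lineRegularize ε G z‖ₑ ≤ ‖G (z + ε * Complex.I)‖ₑ := by
      rw [← ofReal_norm, ← ofReal_norm]
      exact ENNReal.ofReal_le_ofReal h1
    have h3 : z.im ≤ (z + ε * Complex.I).im := by simp [hε]
    gcongr
  · rw [Set.indicator_of_notMem hz]
    exact zero_le

/-- Translation by `iε` makes the function bounded, and the square in the cutoff gives the
integrable majorant `1 / (1 + (εx)²)` on every horizontal line. -/
theorem lintegral_lineRegularize (n : ℕ) {ε : ℝ} (hε : 0 < ε) {G : ℂ → ℂ} (hG : MemBergman n G) :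
    ∃ K : ℝ≥0∞, K ≠ ∞ ∧ ∀ y : ℝ, 0 < y → ∫⁻ x : ℝ, ‖lineRegularize ε G (x + y * Complex.I)‖ₑ ≤ K := by
  obtain ⟨B, hB⟩ := exists_bound_of_bergman n hG hε
  have hi : Integrable fun x : ℝ => B * (1 + (ε * x) ^ 2)⁻¹ :=
    ((integrable_inv_one_add_sq).comp_mul_left' hε.ne').const_mul B
  refine ⟨∫⁻ x : ℝ, ‖B * (1 + (ε * x) ^ 2)⁻¹‖ₑ, hi.2.ne, fun y hy => lintegral_mono fun x => ?_⟩
  have hz : (x : ℂ) + y * Complex.I ∈ halfPlane := by simpa [halfPlane] using hy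
  rw [← ofReal_norm, ← ofReal_norm]
  refine ENNReal.ofReal_le_ofReal ((norm_lineRegularize_le hε.le G hz).trans (le_trans ?_ (le_abs_self _)))
  have h1 := hB ((x : ℂ) + y * Complex.I + ε * Complex.I) (by simp; exact hy.le)
  have h2 : ((x : ℂ) + y * Complex.I).re = x := by simp
  rw [h2]
  gcongr

/-- Paley-Wiener representation on the half-plane. -/
theorem exists_eq_lineLaplace {G : ℂ → ℂ} (hG : DifferentiableOn ℂ G halfPlane) {K : ℝ≥0∞} (hK : K ≠ ∞)
    (hint : ∀ y : ℝ, 0 < y → ∫⁻ x : ℝ, ‖G (x + y * Complex.I)‖ₑ ≤ K) :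
    ∃ g : ℝ → ℂ, Continuous g ∧ (∀ t < 0, g t = 0) ∧ Set.EqOn G (lineLaplace g) halfPlane ∧
      ∀ y : ℝ, 0 < y → ∫⁻ t, ENNReal.ofReal (Real.exp (-(4 * Real.pi * t * y))) * ‖g t‖ₑ ^ 2 ≤
        ∫⁻ x : ℝ, ‖G (x + y * Complex.I)‖ₑ ^ 2 := by
  have hmem : ∀ x y : ℝ, 0 < y → (x : ℂ) + y * Complex.I ∈ halfPlane := fun x y hy => by
    simpa [halfPlane] using hy
  obtain ⟨g, hgc, hgK, hg0, hg2, hginv⟩ := exists_spectrum_of_tube (E := ℝ) (Ω := Set.Ioi 0) (K := K)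
    (F := fun x y => G (x + y * Complex.I)) (convex_Ioi 0)
    (fun s hs y hy => mul_pos hs hy) ⟨1, Set.mem_Ioi.2 one_pos⟩ hK
    (by
      refine hG.continuousOn.comp (f := fun p : ℝ × ℝ => (p.1 : ℂ) + p.2 * Complex.I)
        (Continuous.continuousOn (by fun_prop)) fun p hp => hmem _ _ hp.2)
    (by
      intro x y v
      have : (fun s : ℂ => G (((x + s.re • v : ℝ) : ℂ) + ((y + s.im • v : ℝ) : ℂ) * Complex.I)) =
          fun s => G ((x + y * Complex.I) + s * v) := by
        ext s
        congr 1
        conv_rhs => rw [← Complex.re_add_im s]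
        simp only [smul_eq_mul]
        push_cast
        ring
      rw [this]
      refine hG.comp (by fun_prop) fun s hs => ?_
      have hs' : 0 < y + s.im • v := hs
      simpa [halfPlane] using hs')
    (fun y hy => hint y hy)
  have hin : ∀ y t : ℝ, inner ℝ y t = y * t := fun y t => by simp [mul_comm]
  have hg0' : ∀ t < 0, g t = 0 := fun t ht => hg0 t 1 (Set.mem_Ioi.2 one_pos) (by rw [hin]; linarith)
  refine ⟨g, hgc, hg0', fun z hz => ?_, fun y hy => ?_⟩
  · have hp := Real.pi_pos
    have hz' : 0 < z.im := hz
    have hi : Integrable fun t : ℝ => Real.exp (-(2 * Real.pi) * inner ℝ z.im t) • g t := by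
      refine ((integrable_exp_neg_mul_abs (c := 2 * Real.pi * z.im) (by positivity)).mul_const
        K.toReal).mono' ?_ (Filter.Eventually.of_forall fun t => ?_)
      · simp only [hin]
        exact Continuous.aestronglyMeasurable (by fun_prop)
      · rcases lt_or_ge t 0 with ht | ht
        · rw [hg0' t ht, smul_zero, norm_zero]
          positivity
        · rw [norm_smul, Real.norm_of_nonneg (Real.exp_pos _).le, hin, abs_of_nonneg ht]
          refine mul_le_mul (le_of_eq ?_) (hgK t) (norm_nonneg _) (Real.exp_pos _).le
          ring_nf
    have h1 := hginv z.im hz' hi z.re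
    have h2 := lineLaplace_eq_fourierInv g z.re z.im
    rw [Complex.re_add_im] at h1 h2
    have he : (fun t : ℝ => Real.exp (-(2 * Real.pi) * inner ℝ z.im t) • g t) =
        fun t => Real.exp (-(2 * Real.pi * z.im) * t) • g t := by
      ext t
      rw [hin, neg_mul, neg_mul, ← mul_assoc]
    rw [h1, h2, he]
  · refine le_trans (le_of_eq (lintegral_congr fun t => ?_)) (hg2 y hy)
    rw [enorm_exp_smul_sq, hin]
    congr 4
    ring

/-! ### The bounded right inverse and the equivalence -/

/-- The total mass of the `2m`-th power of the Lorentz form on the slice of the cone at height one. -/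
noncomputable def sliceMass (m : ℕ) : ℝ := (coneMoment (2 * m) 1).toReal

theorem sliceMass_pos (m : ℕ) : 0 < sliceMass m :=
  ENNReal.toReal_pos (coneMoment_one_ne_zero _) (coneMoment_one_ne_top _)

theorem integral_conePow (m : ℕ) {t : ℝ} (ht : 0 < t) :
    ∫ η, conePow (2 * m) (glue t η) = t ^ (4 * m + 2) * sliceMass m := by
  rw [integral_eq_lintegral_of_nonneg_ae (Filter.Eventually.of_forall fun η => conePow_nonneg _ _)
    ((measurable_conePow _).comp (measurable_glue t)).aestronglyMeasurable]
  have h := coneMoment_eq (2 * m) ht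
  rw [coneMoment] at h
  rw [h, ENNReal.toReal_mul, ENNReal.toReal_ofReal (by positivity), sliceMass]
  congr 2
  ring

/-- The density on the cone whose Laplace transform extends the Laplace transform of `g`. -/
noncomputable def liftDensity (m : ℕ) (g : ℝ → ℂ) (ξ : Fin 3 → ℝ) : ℂ :=
  -- Equality in Cauchy-Schwarz forces proportionality to the `m`-th power of the form on each
  -- slice; the factor depending on `ξ 0` is normalised by the marginal. At `ξ 0 = 0` the inverse is
  -- 0 or 1 by convention only on a null set.
  (((2 * Real.pi) ^ (2 * m) * sliceMass m)⁻¹ * (ξ 0 ^ (4 * m + 2))⁻¹ * conePow m ξ : ℝ) * g (ξ 0)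

theorem measurable_liftDensity (m : ℕ) {g : ℝ → ℂ} (hg : Continuous g) : Measurable (liftDensity m g) := by
  have h1 := measurable_conePow m
  have h2 : Measurable fun ξ : Fin 3 → ℝ => g (ξ 0) := hg.measurable.comp (measurable_pi_apply 0)
  unfold liftDensity
  refine Measurable.mul (Complex.measurable_ofReal.comp ?_) h2
  fun_prop

theorem liftDensity_eq_zero (m : ℕ) (g : ℝ → ℂ) : ∀ ξ ∉ closedCone, liftDensity m g ξ = 0 := by
  intro ξ hξ
  simp [liftDensity, conePow, hξ]

theorem marginal_liftDensity (m : ℕ) (g : ℝ → ℂ) {t : ℝ} (ht : 0 < t) :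
    marginal (fun ξ => (((2 * Real.pi) ^ 2 * lorentzForm ξ) ^ m : ℝ) * liftDensity m g ξ) t = g t := by
  have hp := Real.pi_pos
  have hs := sliceMass_pos m
  have h : ∀ ξ, ((((2 * Real.pi) ^ 2 * lorentzForm ξ) ^ m : ℝ) : ℂ) * liftDensity m g ξ =
      ((sliceMass m)⁻¹ * (ξ 0 ^ (4 * m + 2))⁻¹ * conePow (2 * m) ξ : ℝ) * g (ξ 0) := by
    intro ξ
    rw [liftDensity, ← mul_assoc, ← Complex.ofReal_mul]
    congr 2
    rw [← conePow_mul_self]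
    by_cases hξ : ξ ∈ closedCone
    · simp only [conePow, Set.indicator_of_mem hξ, mul_pow ((2 * Real.pi) ^ 2), ← pow_mul, mul_inv]
      have : (2 * Real.pi) ^ (2 * m) ≠ 0 := by positivity
      field_simp
    · simp [conePow, hξ]
  have h0 : ∀ η, glue t η 0 = t := fun _ => rfl
  simp only [marginal, h, h0]
  rw [integral_mul_const, integral_complex_ofReal, integral_const_mul, integral_conePow m ht]
  have : (sliceMass m)⁻¹ * (t ^ (4 * m + 2))⁻¹ * (t ^ (4 * m + 2) * sliceMass m) = 1 := by
    field_simp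
  rw [this]
  simp

/-- The norm of the extension operator, on the Fourier side. -/
noncomputable def extensionConst (m : ℕ) : ℝ≥0∞ :=
  ENNReal.ofReal ((((2 * Real.pi) ^ (2 * m) * sliceMass m)⁻¹) ^ 2 *
    ((4 * Real.pi) ^ (4 * m + 2) / (4 * m + 1).factorial)) * coneMoment (2 * m) 1

theorem extensionConst_ne_top (m : ℕ) : extensionConst m ≠ ∞ :=
  ENNReal.mul_ne_top ENNReal.ofReal_ne_top (coneMoment_one_ne_top _)

/-- The normalisation contributes `t^{-2(4m+2)}` and the slice moment `t^{4m+2}`; their product is,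
up to a constant, the Bergman weight on the Fourier side. -/
theorem lintegral_liftDensity_sq_le (m : ℕ) {g : ℝ → ℂ} (hg : Continuous g) (hg0 : ∀ t < 0, g t = 0) :
    ∫⁻ ξ, ‖liftDensity m g ξ‖ₑ ^ 2 ≤ extensionConst m *
      ∫⁻ t, ENNReal.ofReal ((4 * m + 1).factorial / (4 * Real.pi * t) ^ (4 * m + 1 + 1)) * ‖g t‖ₑ ^ 2 := by
  have hp := Real.pi_pos
  have hs := sliceMass_pos m
  rw [lintegral_eq_lintegral_glue ((measurable_liftDensity m hg).enorm.pow_const 2),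
    ← lintegral_const_mul' _ _ (extensionConst_ne_top m)]
  refine lintegral_mono_ae ?_
  filter_upwards [Measure.ae_ne volume (0 : ℝ)] with t ht
  rcases lt_or_gt_of_ne ht with h0 | h0
  · have : ∀ η, liftDensity m g (glue t η) = 0 := fun η => by
      rw [liftDensity, show g (glue t η 0) = 0 from hg0 t h0, mul_zero]
    simp [this]
  · have h1 : ∀ η, ‖liftDensity m g (glue t η)‖ₑ ^ 2 =
        ENNReal.ofReal ((((2 * Real.pi) ^ (2 * m) * sliceMass m)⁻¹ * (t ^ (4 * m + 2))⁻¹) ^ 2) *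
          ‖g t‖ₑ ^ 2 * ENNReal.ofReal (conePow (2 * m) (glue t η)) := by
      intro η
      have hc := conePow_nonneg m (glue t η)
      rw [liftDensity, show glue t η 0 = t from rfl, enorm_mul, mul_pow, ← ofReal_norm, Complex.norm_real,
        Real.norm_of_nonneg (by positivity), ← ENNReal.ofReal_pow (by positivity), mul_pow,
        ENNReal.ofReal_mul (by positivity), pow_two (conePow m _), conePow_mul_self]
      ring
    simp only [h1]
    rw [lintegral_const_mul' _ _ (ENNReal.mul_ne_top ENNReal.ofReal_ne_top (ENNReal.pow_ne_top enorm_ne_top))]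
    change _ * coneMoment (2 * m) t ≤ _
    rw [coneMoment_eq _ h0, extensionConst]
    refine le_of_eq ?_
    have e1 : (((2 * Real.pi) ^ (2 * m) * sliceMass m)⁻¹ * (t ^ (4 * m + 2))⁻¹) ^ 2 * t ^ (2 * (2 * m) + 2) =
        (((2 * Real.pi) ^ (2 * m) * sliceMass m)⁻¹) ^ 2 *
        ((4 * Real.pi) ^ (4 * m + 2) / (4 * m + 1).factorial) *
        ((4 * m + 1).factorial / (4 * Real.pi * t) ^ (4 * m + 1 + 1)) := by
      have hf : ((4 * m + 1).factorial : ℝ) ≠ 0 := by exact_mod_cast (4 * m + 1).factorial_ne_zero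
      rw [mul_pow (4 * Real.pi) t, show 2 * (2 * m) + 2 = 4 * m + 2 by ring,
        show 4 * m + 1 + 1 = 4 * m + 2 by ring, mul_pow _ (t ^ (4 * m + 2))⁻¹]
      have h2 : (4 * Real.pi) ^ (4 * m + 2) ≠ 0 := by positivity
      have h3 : t ^ (4 * m + 2) ≠ 0 := by positivity
      generalize (4 * Real.pi) ^ (4 * m + 2) = A at *
      generalize t ^ (4 * m + 2) = T at *
      field_simp
    calc _ = ENNReal.ofReal ((((2 * Real.pi) ^ (2 * m) * sliceMass m)⁻¹ * (t ^ (4 * m + 2))⁻¹) ^ 2) *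
          ENNReal.ofReal (t ^ (2 * (2 * m) + 2)) * (coneMoment (2 * m) 1 * ‖g t‖ₑ ^ 2) := by ring
      _ = _ := by
        rw [← ENNReal.ofReal_mul (by positivity), e1, ENNReal.ofReal_mul (by positivity)]
        ring

/-- The restriction of the iterated Box operator has a bounded right inverse on a dense class. -/
theorem exists_hardy_extension (m : ℕ) {G : ℂ → ℂ} (hG : DifferentiableOn ℂ G halfPlane)
    (hfin : bergmanNorm ((4 * m + 1 : ℕ) : ℝ) G < ∞) {K : ℝ≥0∞} (hK : K ≠ ∞)
    (hint : ∀ y : ℝ, 0 < y → ∫⁻ x : ℝ, ‖G (x + y * Complex.I)‖ₑ ≤ K) :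
    ∃ F, MemHardy F ∧ (∀ z ∈ halfPlane, box^[m] F ![z, 0, 0] = G z) ∧
      hardyNorm F ^ 2 ≤ extensionConst m * bergmanNorm ((4 * m + 1 : ℕ) : ℝ) G ^ 2 := by
  obtain ⟨g, hgc, hg0, hGg, hg2⟩ := exists_eq_lineLaplace hG hK hint
  have hg0' : ∀ᵐ t : ℝ, t ≤ 0 → g t = 0 := by
    filter_upwards [Measure.ae_ne volume (0 : ℝ)] with t ht h
    exact hg0 t (lt_of_le_of_ne h ht)
  -- Plancherel's inequality for the direct transform: the spectral side is bounded by the Bergman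
  -- norm, opposite to `bergmanNorm_lineLaplace_sq_le`.
  have hb : ∫⁻ t, ENNReal.ofReal ((4 * m + 1).factorial / (4 * Real.pi * t) ^ (4 * m + 1 + 1)) * ‖g t‖ₑ ^ 2 ≤
      bergmanNorm ((4 * m + 1 : ℕ) : ℝ) G ^ 2 := by
    rw [← lintegral_weight_exp (4 * m + 1) hgc.aestronglyMeasurable hg0', bergmanNorm_sq_eq _ hG.continuousOn]
    exact setLIntegral_mono' measurableSet_Ioi fun y hy => mul_le_mul_right (hg2 y hy) _
  have hsq : ∫⁻ ξ, ‖liftDensity m g ξ‖ₑ ^ 2 ≤ extensionConst m * bergmanNorm ((4 * m + 1 : ℕ) : ℝ) G ^ 2 :=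
    (lintegral_liftDensity_sq_le m hgc hg0).trans (mul_le_mul_right hb _)
  have hfin' : extensionConst m * bergmanNorm ((4 * m + 1 : ℕ) : ℝ) G ^ 2 < ∞ :=
    ENNReal.mul_lt_top (extensionConst_ne_top m).lt_top (ENNReal.pow_lt_top hfin)
  have hd : IsConeDensity (liftDensity m g) :=
    isConeDensity_of_sq (measurable_liftDensity m hgc) (hsq.trans_lt hfin').ne (liftDensity_eq_zero m g)
  have hF := (hardyNorm_laplace_sq_le hd).trans hsq
  refine ⟨laplace (liftDensity m g), ⟨hd.differentiableOn_laplace, ?_⟩, fun z hz => ?_, hF⟩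
  · exact (ENNReal.pow_lt_top_iff.1 (hF.trans_lt hfin')).resolve_right two_ne_zero
  · have hk := hd.lorentzForm_pow_mul m
    rw [hd.iterate_box_laplace m (slice_mem_tube hz), hk.laplace_slice hz, hGg hz]
    refine integral_congr_ae ?_
    filter_upwards [hg0', ae_marginal_eq_zero hk.eq_zero] with t h1 h2
    rcases le_or_gt t 0 with h | h
    · rw [h1 h, h2 h]
    · rw [marginal_liftDensity m g h]

/-- The box Carleson inequality is applied to the extension of each regularisation of `G`, with
constants independent of `n`; Fatou's lemma for `μ` then needs only pointwise convergence on the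
half-plane. -/
theorem isBergmanCarleson_of_isBoxCarleson (m : ℕ) {μ : Measure ℂ}
    (h : IsBoxCarleson m (prodDirac μ)) : IsBergmanCarleson ((4 * m + 1 : ℕ) : ℝ) μ := by
  obtain ⟨C, hC, hle⟩ := h
  refine ⟨C * (extensionConst m).toNNReal + 1, by positivity, fun G hG => ?_⟩
  have hCE : ((C * (extensionConst m).toNNReal + 1 : ℝ≥0) : ℝ≥0∞) = C * extensionConst m + 1 := by
    push_cast
    rw [ENNReal.coe_toNNReal (extensionConst_ne_top m)]
  rw [hCE]
  have hdε : ∀ n : ℕ, DifferentiableOn ℂ (lineRegularize (1 / ((n : ℝ) + 1)) G) halfPlane := fun n =>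
    differentiableOn_lineRegularize (by positivity) hG.1
  refine lintegral_le_of_tendsto (φ := fun n z => ‖lineRegularize (1 / ((n : ℝ) + 1)) G z‖ₑ ^ 2) ?_ ?_ ?_
  · intro n
    exact ((hdε n).continuousOn.aestronglyMeasurable isOpen_halfPlane.measurableSet).enorm.pow_const 2
  · intro n
    have hε : 0 < 1 / ((n : ℝ) + 1) := by positivity
    have hnorm := bergmanNorm_lineRegularize_sq_le (4 * m + 1) hε.le G
    obtain ⟨K, hK, hint⟩ := lintegral_lineRegularize (4 * m + 1) hε hG
    obtain ⟨F, hF, hbox, hFn⟩ := exists_hardy_extension m (hdε n)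
      ((ENNReal.pow_lt_top_iff.1 (hnorm.trans_lt (ENNReal.pow_lt_top hG.2))).resolve_right two_ne_zero) hK hint
    have h1 := hle F hF
    rw [setLIntegral_prodDirac μ (differentiableOn_iterate_box isOpen_tube hF.1 m).continuousOn] at h1
    calc ∫⁻ z in halfPlane, ‖lineRegularize (1 / ((n : ℝ) + 1)) G z‖ₑ ^ 2 ∂μ
        = ∫⁻ z in halfPlane, ‖box^[m] F ![z, 0, 0]‖ₑ ^ 2 ∂μ :=
          setLIntegral_congr_fun isOpen_halfPlane.measurableSet fun z hz => by simp only [hbox z hz]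
      _ ≤ C * hardyNorm F ^ 2 := h1
      _ ≤ C * (extensionConst m * bergmanNorm ((4 * m + 1 : ℕ) : ℝ) G ^ 2) := by
        gcongr
        exact hFn.trans (mul_le_mul_right hnorm _)
      _ ≤ _ := by
        rw [← mul_assoc]
        gcongr
        exact le_self_add
  · refine (ae_restrict_iff' isOpen_halfPlane.measurableSet).2 (Filter.Eventually.of_forall fun z hz => ?_)
    have h0 := tendsto_one_div_add_atTop_nhds_zero_nat (𝕜 := ℝ)
    have hG' : ContinuousAt G (z + ((0 : ℝ) : ℂ) * Complex.I) := by
      simp only [Complex.ofReal_zero, zero_mul, add_zero]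
      exact hG.1.continuousOn.continuousAt (isOpen_halfPlane.mem_nhds hz)
    have hc : ContinuousAt (fun ε : ℝ => lineRegularize ε G z) 0 := by
      refine ContinuousAt.mul (ContinuousAt.comp (f := fun ε : ℝ => z + (ε : ℂ) * Complex.I) hG'
        (Continuous.continuousAt (by fun_prop))) (ContinuousAt.inv₀ (Continuous.continuousAt (by fun_prop)) ?_)
      simp
    have h1 := hc.tendsto.comp h0
    have h2 : lineRegularize 0 G z = G z := by simp [lineRegularize]
    rw [h2] at h1
    exact ((ENNReal.continuous_pow 2).tendsto _).comp h1.enorm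

end LorentzTube

/-- The hypothesis `hμ` expresses that `μ` is a measure on the half-plane. The Bergman exponent is a
natural number, which turns the real power in the weight into an ordinary one. -/
theorem mainTheorem4 (μ : Measure ℂ) (hμ : μ LorentzTube.halfPlaneᶜ = 0) (m : ℕ) :
    LorentzTube.IsBoxCarleson m (LorentzTube.prodDirac μ) ↔
      LorentzTube.IsBergmanCarleson (4 * (m : ℝ) + 1) μ := by
  have h : (4 * (m : ℝ) + 1) = ((4 * m + 1 : ℕ) : ℝ) := by push_cast; rfl
  rw [h]
  exact ⟨LorentzTube.isBergmanCarleson_of_isBoxCarleson m, LorentzTube.isBoxCarleson_of_isBergmanCarleson m⟩
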